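/- All Hilbert spaces are finite-dimensional; operators on them are matrices. For a Hermitian operator $X$ put $\|X\|_1=\operatorname{Tr}\sqrt{X^\dagger X}$, $\|X\|_+=\frac12|\operatorname{Tr}X|+\frac12\|X\|_1$, and let $\operatorname{supp}(X)$ be its range. A state is a positive semidefinite operator of trace one. For $\sigma\ge 0$ let $J_\sigma(X)=\frac12(\sigma X+X\sigma)$ act on Hermitian operators, and let $J_\sigma^{-1}$ be its inverse on its range. The Bures seminorm is $\|X\|_{B,\sigma}=\sqrt{\operatorname{Tr}XJ_\sigma^{-1}(X)}$ if $X\in\operatorname{ran}(J_\sigma)$, and $\|X\|_{B,\sigma}=\infty$ otherwise. For nonnegative vectors $p,q$ on a finite alphabet let $D_2(p\|q)=\log\sum_x p(x)^2/q(x)$ (with $0/0=0$ and $a/0=\infty$ for $a>0$) and $D_{\max}(p\|q)=\log\inf\{\lambda\ge0: p\le\lambda q\}$. For $\alpha\in\{2,\max\}$ put $$D_\alpha^{\varepsilon,T}(p\|q)=\inf\{D_\alpha(p'\|q): p'\ge0,\ \textstyle\sum_x p'(x)\le1,\ \|p-p'\|_+\le\varepsilon\},$$ where $\|x\|_+=\frac12|\sum_i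 x_i|+\frac12\sum_i|x_i|$ for vectors, and $$D_\alpha^{\varepsilon,\mathbb M}(\rho\|\sigma)=\sup_{\mathcal M}D_\alpha^{\varepsilon,T}(\mathcal M(\rho)\|\mathcal M(\sigma)),\qquad Q_\alpha^{\varepsilon,\mathbb M}(\rho\|\sigma)=\exp D_\alpha^{\varepsilon,\mathbb M}(\rho\|\sigma),$$ the supremum running over all measurements $\mathcal M(X)=(\operatorname{Tr}M_iX)_{i=1}^k$, $M_i\ge0$, $\sum_iM_i=1$, $k\in\mathbb N$. A probability measure $\nu$ on the unitary group of $A$ is a unitary 2-design if $\mathbb E_{U\sim\nu}[U^{\otimes2}M(U^\dagger)^{\otimes2}]=\mathbb E_{U\sim\mathrm{Haar}}[U^{\otimes2}M(U^\dagger)^{\otimes2}]$ for every operator $M$ on $A^{\otimes 2}$. Write $\mathcal U(X_{AE})=(U\otimes1_E)X_{AE}(U^\dagger\otimes1_E)$. **Theorem (tightened one-shot decoupling).** Let $A=A_1A_2$ be a bipartite quantum system with $|A|=|A_1||A_2|\geq 1$, let $\sigma_E$ be a state on a system $E$, and let $U$ be drawn from a unitary 2-design on $A$. 1. For every Hermitian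 operator $R_{AE}$ with $\operatorname{supp}(R_{AE})\subseteq\operatorname{supp}(1_A\otimes\sigma_E)$ and with $R_E=\operatorname{Tr}_AR_{AE}$, $$\mathbb E_U\Big\|\operatorname{Tr}_{A_2}[\mathcal U(R_{AE})]-\frac{1_{A_1}}{|A_1|}\otimes R_E\Big\|_+\le\frac12\sqrt{\frac{|A|(|A_1|^2-1)}{|A|^2-1}}\;\Big\|R_{AE}-\frac{1_A}{|A|}\otimes R_E\Big\|_{B,\,1_A\otimes\sigma_E},$$ where the fraction is read as $0$ if $|A|=1$. 2. For every state $\rho_{AE}$ with $\operatorname{supp}(\rho_{AE})\subseteq\operatorname{supp}(1_A\otimes\sigma_E)$ and every $\varepsilon\in[0,1)$, $$\mathbb E_U\,\frac12\Big\|\operatorname{Tr}_{A_2}[\mathcal U(\rho_{AE})]-\frac{1_{A_1}}{|A_1|}\otimes\rho_E\Big\|_1\le\varepsilon+\frac12\sqrt{\frac{|A_1|}{|A_2|}\,Q_2^{\varepsilon,\mathbb M}(\rho_{AE}\|1_A\otimes\sigma_E)}\le\varepsilon+\frac12\sqrt{\frac{|A_1|}{|A_2|}(1-\varepsilon)\,Q_{\max}^{\varepsilon,\mathbb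 M}(\rho_{AE}\|1_A\otimes\sigma_E)}.$$ -/

import Mathlib

open MeasureTheory Matrix
open scoped Kronecker ComplexOrder MatrixOrder ENNReal NNReal

namespace Decoupling

noncomputable section

/-! ### Operators, states and norms

Operators on a Hilbert space of dimension `|n|` are matrices `Matrix n n ℂ`; the composite of two
systems is indexed by the product type. -/

section Operators

variable {n : Type*} [Fintype n] [DecidableEq n]

/-- A quantum state: a positive semidefinite operator of trace one. -/
def IsState (ρ : Matrix n n ℂ) : Prop := ρ.PosSemidef ∧ ρ.trace = 1

/-- The support of a Hermitian operator, i.e. its range (the orthogonal complement of its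
kernel). -/
def supp (X : Matrix n n ℂ) : Submodule ℂ (n → ℂ) := LinearMap.range X.mulVecLin

/-- The Schatten 1-norm `Tr √(X† X)`. -/
def traceNorm (X : Matrix n n ℂ) : ℝ := (CFC.sqrt (Xᴴ * X)).trace.re

/-- The norm `‖X‖₊ = ½ |Tr X| + ½ ‖X‖₁`. -/
def plusNorm (X : Matrix n n ℂ) : ℝ := 1 / 2 * ‖X.trace‖ + 1 / 2 * traceNorm X

/-- The superoperator `J_σ(X) = ½ (σ X + X σ)`. -/
def lyap (σ X : Matrix n n ℂ) : Matrix n n ℂ := (1 / 2 : ℂ) • (σ * X + X * σ)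

/-- The range of `J_σ`, acting on Hermitian operators. -/
def lyapRange (σ : Matrix n n ℂ) : Set (Matrix n n ℂ) := lyap σ '' {Z | Z.IsHermitian}

/-- The inverse of `J_σ` on its range: for `X` in the range of `J_σ` this is the `Z` in the range
of `J_σ` with `J_σ(Z) = X` (unique for `σ ≥ 0`). -/
def lyapInv (σ X : Matrix n n ℂ) : Matrix n n ℂ := Function.invFunOn (lyap σ) (lyapRange σ) X

open scoped Classical in
/-- The Bures seminorm `‖X‖_{B,σ}`: it is `√(Tr X J_σ⁻¹(X))` if `X` is in the range of `J_σ`, and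
`∞` otherwise. -/
def buresNorm (σ X : Matrix n n ℂ) : ℝ≥0∞ :=
  if X ∈ lyapRange σ then ENNReal.ofReal (Real.sqrt (X * lyapInv σ X).trace.re) else ⊤

end Operators

/-! ### Classical smooth divergences

Classical distributions on an alphabet `Fin k` are functions `Fin k → ℝ`. -/

section Classical

variable {k : ℕ}

/-- The classical form (for diagonal operators) of the norm `‖x‖₊ = ½ |∑ x| + ½ ∑ |x|`. -/
def classicalPlusNorm (x : Fin k → ℝ) : ℝ := 1 / 2 * |∑ i, x i| + 1 / 2 * ∑ i, |x i|

/-- The smoothing ball: subnormalised distributions `p'` with `‖p - p'‖₊ ≤ ε`. -/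
def smoothingBall (ε : ℝ) (p : Fin k → ℝ) : Set (Fin k → ℝ) :=
  {p' | (∀ i, 0 ≤ p' i) ∧ ∑ i, p' i ≤ 1 ∧ classicalPlusNorm (fun i => p i - p' i) ≤ ε}

/-- The classical Rényi divergence of order two, `log ∑ p² / q`, where `0 / 0 = 0` and
`a / 0 = ∞` for `a > 0` (these are the conventions of `ℝ≥0∞`). -/
def classicalD2 (p q : Fin k → ℝ) : EReal :=
  ENNReal.log (∑ i, ENNReal.ofReal (p i ^ 2) / ENNReal.ofReal (q i))

/-- The classical max-relative entropy, `log inf {t ≥ 0 | p ≤ t q}`, with `inf ∅ = ∞`. -/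
def classicalDmax (p q : Fin k → ℝ) : EReal :=
  ENNReal.log (⨅ t ∈ {t : ℝ≥0 | ∀ i, p i ≤ t * q i}, (t : ℝ≥0∞))

/-- The classical smooth collision divergence `D₂^{ε,T}`. -/
def smoothD2 (ε : ℝ) (p q : Fin k → ℝ) : EReal :=
  ⨅ p' ∈ smoothingBall ε p, classicalD2 p' q

/-- The classical smooth max-relative entropy `D_max^{ε,T}`. -/
def smoothDmax (ε : ℝ) (p q : Fin k → ℝ) : EReal :=
  ⨅ p' ∈ smoothingBall ε p, classicalDmax p' q

end Classical

/-! ### Measurements and measured smooth divergences -/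

section Measured

variable {n : Type*} [Fintype n] [DecidableEq n]

/-- A quantum measurement (POVM) with `k` outcomes. -/
structure Measurement (n : Type*) [Fintype n] [DecidableEq n] (k : ℕ) where
  /-- The POVM elements. -/
  elem : Fin k → Matrix n n ℂ
  posSemidef : ∀ i, (elem i).PosSemidef
  sum_eq_one : ∑ i, elem i = 1

/-- The outcome distribution `i ↦ Tr (M_i X)` of a measurement on a Hermitian operator `X`. -/
def Measurement.outcome {k : ℕ} (M : Measurement n k) (X : Matrix n n ℂ) : Fin k → ℝ :=
  fun i => (M.elem i * X).trace.re

/-- The measured smooth collision divergence `D₂^{ε,𝕄}`. -/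
def measuredD2 (ε : ℝ) (ρ σ : Matrix n n ℂ) : EReal :=
  ⨆ (k : ℕ) (M : Measurement n k), smoothD2 ε (M.outcome ρ) (M.outcome σ)

/-- The measured smooth max-relative entropy `D_max^{ε,𝕄}`. -/
def measuredDmax (ε : ℝ) (ρ σ : Matrix n n ℂ) : EReal :=
  ⨆ (k : ℕ) (M : Measurement n k), smoothDmax ε (M.outcome ρ) (M.outcome σ)

/-- `Q₂^{ε,𝕄} = exp D₂^{ε,𝕄}`. -/
def measuredQ2 (ε : ℝ) (ρ σ : Matrix n n ℂ) : ℝ≥0∞ := EReal.exp (measuredD2 ε ρ σ)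

/-- `Q_max^{ε,𝕄} = exp D_max^{ε,𝕄}`. -/
def measuredQmax (ε : ℝ) (ρ σ : Matrix n n ℂ) : ℝ≥0∞ := EReal.exp (measuredDmax ε ρ σ)

end Measured

/-! ### Unitary 2-designs -/

section Design

variable {n : Type*} [Fintype n] [DecidableEq n]

instance instMeasurableSpaceUnitaryGroup : MeasurableSpace (unitaryGroup n ℂ) := borel _

instance instBorelSpaceUnitaryGroup : BorelSpace (unitaryGroup n ℂ) := ⟨rfl⟩

instance instCompactSpaceUnitaryGroup : CompactSpace (unitaryGroup n ℂ) := by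
  have hsub : (unitaryGroup n ℂ : Set (Matrix n n ℂ)) ⊆
      Set.univ.pi fun _ => Set.univ.pi fun _ => Metric.closedBall (0 : ℂ) 1 := by
    intro U hU i _ j _
    simpa using entry_norm_bound_of_unitary hU i j
  have hclosed : IsClosed (unitaryGroup n ℂ : Set (Matrix n n ℂ)) := by
    have : (unitaryGroup n ℂ : Set (Matrix n n ℂ)) = {U | U * star U = 1} := by
      ext U
      exact mem_unitaryGroup_iff
    rw [this]
    exact isClosed_eq (by fun_prop) continuous_const
  have hcomp : IsCompact (unitaryGroup n ℂ : Set (Matrix n n ℂ)) :=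
    (isCompact_univ_pi fun _ => isCompact_univ_pi fun _ =>
      isCompact_closedBall (0 : ℂ) 1).of_isClosed_subset hclosed hsub
  exact isCompact_iff_compactSpace.mp hcomp

/-- The Haar measure on the unitary group, normalised to total mass one. -/
def haarUnitary (n : Type*) [Fintype n] [DecidableEq n] : Measure (unitaryGroup n ℂ) :=
  Measure.haarMeasure ⊤

/-- The matrix `U^{⊗2} M (U†)^{⊗2}`. -/
def twofoldConj (M : Matrix (n × n) (n × n) ℂ) (U : unitaryGroup n ℂ) :
    Matrix (n × n) (n × n) ℂ :=
  ((U : Matrix n n ℂ) ⊗ₖ (U : Matrix n n ℂ)) * M *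
    ((U : Matrix n n ℂ)ᴴ ⊗ₖ (U : Matrix n n ℂ)ᴴ)

/-- A unitary 2-design: a probability measure on the unitary group with the same second-moment
twirl as the Haar measure (the expectations of matrices are taken entrywise). -/
def IsUnitaryTwoDesign (ν : Measure (unitaryGroup n ℂ)) : Prop :=
  IsProbabilityMeasure ν ∧
    ∀ (M : Matrix (n × n) (n × n) ℂ) (i j : n × n),
      ∫ U, twofoldConj M U i j ∂ν = ∫ U, twofoldConj M U i j ∂(haarUnitary n)

end Design

/-! ### Bipartite and tripartite systems -/

section Systems

variable {a a₁ a₂ e : Type*}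

/-- The unitary channel `X_{AE} ↦ (U_A ⊗ 1_E) X_{AE} (U_A† ⊗ 1_E)`. -/
def unitaryChannel [Fintype a] [DecidableEq a] [Fintype e] [DecidableEq e]
    (U : unitaryGroup a ℂ) (X : Matrix (a × e) (a × e) ℂ) : Matrix (a × e) (a × e) ℂ :=
  ((U : Matrix a a ℂ) ⊗ₖ (1 : Matrix e e ℂ)) * X *
    ((U : Matrix a a ℂ)ᴴ ⊗ₖ (1 : Matrix e e ℂ))

/-- The partial trace `Tr_{A₂}` from `A₁ A₂ E` to `A₁ E`. -/
def traceA2 [Fintype a₂] (X : Matrix ((a₁ × a₂) × e) ((a₁ × a₂) × e) ℂ) :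
    Matrix (a₁ × e) (a₁ × e) ℂ :=
  Matrix.of fun i j => ∑ l, X ((i.1, l), i.2) ((j.1, l), j.2)

/-- The marginal `X_E = Tr_A X_{AE}`. -/
def marginalE [Fintype a] (X : Matrix (a × e) (a × e) ℂ) : Matrix e e ℂ :=
  Matrix.of fun i j => ∑ l, X (l, i) (l, j)

/-- The maximally mixed state `1_A / |A|`. -/
def maxMixed (a : Type*) [Fintype a] [DecidableEq a] : Matrix a a ℂ :=
  (Fintype.card a : ℂ)⁻¹ • 1

/-- The decoupling difference `Tr_{A₂}[U_A(X_{AE})] - 1_{A₁} / |A₁| ⊗ X_E`. -/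
def decouplingDiff [Fintype a₁] [DecidableEq a₁] [Fintype a₂] [DecidableEq a₂]
    [Fintype e] [DecidableEq e] (X : Matrix ((a₁ × a₂) × e) ((a₁ × a₂) × e) ℂ)
    (U : unitaryGroup (a₁ × a₂) ℂ) : Matrix (a₁ × e) (a₁ × e) ℂ :=
  traceA2 (unitaryChannel U X) - maxMixed a₁ ⊗ₖ marginalE X

end Systems

end

end Decoupling

open Decoupling

/-! Subtracting `π_A ⊗ R_E` from `R` leaves an operator `Y` with `Y_E = 0`, and the decoupling
difference is `Tr_{A₂} U(Y)`. It is traceless, so its plus norm is half its trace norm. If `Y =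
J_{1⊗σ}(Z)`, then, since `U` and `Tr_{A₂}` do not touch `E`, also `Tr_{A₂} U(Y) = J_{1⊗σ}(Tr_{A₂}
U(Z))`. Testing against the sign `S` and using Cauchy–Schwarz for `Tr X J(Y)` bounds the squared
trace norm by `|A₁| Tr σ · Tr[Tr_{A₂}U(Y) Tr_{A₂}U(Z)]` (`trace_mul_le_sqrt`). The last factor is
quadratic in `U ⊗ U†`; as `Y_E = 0`, a 2-design averages it to exactly `designFactor · Tr YZ`.
Jensen's inequality for the square root then gives the first bound (`lintegral_le_of_le_sqrt`).

The second moments come from `commutant_entry_eq`: an operator commuting with all `V ⊗ V` commutes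
with all `A ⊗ 1 + 1 ⊗ A`, and contracting indices of that relation determines it up to one constant
once a partial trace vanishes.

For the smoothed bound, let `X ≥ 0`, `Tr X ≤ ε`, be closest to `ρ` in the Bures norm. The part `X`
contributes at most `ε`; the rest `ρ - X = J(Z)` obeys the second-moment bound. Its squared Bures
norm is at most `Q₂^{ε,𝕄}`: measure in the eigenbasis of `Z`, linearise by `x²/q ≥ 2xh - qh²` with
`h` the eigenvalues, and let the optimality of `X` pay for the smoothing
(`exists_smoothing_le_measuredQ2`). A regularisation `σ + δ1` keeps `J` invertible, and `δ → 0` at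
the end. The comparison of `Q₂` with `Q_max` is classical and holds measurement by measurement. -/

set_option linter.unusedSectionVars false

namespace Decoupling

/-! ### Hermitian unitaries and the trace norm. -/

section MatrixFacts

variable {n : Type*} [Fintype n] [DecidableEq n]

theorem exists_unitary_diagonalization {Z : Matrix n n ℂ} (hZ : Z.IsHermitian) :
    ∃ (U : Matrix n n ℂ) (h : n → ℝ), Uᴴ * U = 1 ∧ U * Uᴴ = 1 ∧
      Z = U * diagonal (fun i => (h i : ℂ)) * Uᴴ := by
  refine ⟨hZ.eigenvectorUnitary, hZ.eigenvalues, ?_, ?_, ?_⟩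
  · exact Unitary.coe_star_mul_self _
  · exact Unitary.coe_mul_star_self _
  · conv_lhs => rw [hZ.spectral_theorem, Unitary.conjStarAlgAut_apply]
    rfl

theorem conj_diagonal_mul_conj_diagonal {U : Matrix n n ℂ} (hU : Uᴴ * U = 1) (f g : n → ℂ) :
    (U * diagonal f * Uᴴ) * (U * diagonal g * Uᴴ) = U * diagonal (fun i => f i * g i) * Uᴴ := by
  calc _ = U * diagonal f * (Uᴴ * U) * diagonal g * Uᴴ := by simp only [Matrix.mul_assoc]
    _ = _ := by rw [hU, Matrix.mul_one, Matrix.mul_assoc U, diagonal_mul_diagonal]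

theorem isHermitian_conj_diagonal (U : Matrix n n ℂ) (f : n → ℝ) :
    (U * diagonal (fun i => (f i : ℂ)) * Uᴴ).IsHermitian := by
  refine isHermitian_mul_mul_conjTranspose U ?_
  rw [isHermitian_diagonal_iff]
  intro i
  simp [isSelfAdjoint_iff]

/-- The trace norm of a Hermitian matrix is attained at a Hermitian unitary (its sign). -/
theorem exists_traceNorm_eq {Y : Matrix n n ℂ} (hY : Y.IsHermitian) :
    ∃ S : Matrix n n ℂ, S.IsHermitian ∧ S * S = 1 ∧ traceNorm Y = (S * Y).trace.re := by
  obtain ⟨U, h, hU, hU', rfl⟩ := exists_unitary_diagonalization hY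
  -- The sign of zero is `1`, so that `S * S = 1` even when `Y` is singular.
  let s : n → ℝ := fun i => if h i < 0 then -1 else 1
  have hs : ∀ i, s i * s i = 1 := fun i => by by_cases hi : h i < 0 <;> simp [s, hi]
  have hsh : ∀ i, s i * h i = |h i| := fun i => by
    by_cases hi : h i < 0
    · simp [s, hi, abs_of_neg hi]
    · simp [s, hi, abs_of_nonneg (not_lt.mp hi)]
  refine ⟨U * diagonal (fun i => (s i : ℂ)) * Uᴴ, isHermitian_conj_diagonal U s, ?_, ?_⟩
  · rw [conj_diagonal_mul_conj_diagonal hU]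
    have : (fun i => (s i : ℂ) * s i) = fun _ => 1 := by
      funext i; exact_mod_cast congrArg (fun x : ℝ => (x : ℂ)) (hs i)
    rw [this, diagonal_one, Matrix.mul_one, hU']
  · rw [traceNorm, hY.eq]
    congr 2
    refine CFC.sqrt_unique ?_ ?_
    · rw [conj_diagonal_mul_conj_diagonal hU, conj_diagonal_mul_conj_diagonal hU,
        conj_diagonal_mul_conj_diagonal hU]
      congr 3
      funext i
      have := hs i
      have h2 : s i * h i * (s i * h i) = h i * h i := by
        linear_combination h i * h i * this
      exact_mod_cast congrArg (fun x : ℝ => (x : ℂ)) h2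
    · rw [conj_diagonal_mul_conj_diagonal hU, Matrix.nonneg_iff_posSemidef]
      refine PosSemidef.mul_mul_conjTranspose_same ?_ U
      rw [posSemidef_diagonal_iff]
      intro i
      have : (0 : ℝ) ≤ s i * h i := by rw [hsh]; exact abs_nonneg _
      exact_mod_cast this

theorem trace_mul_nonneg_of_posSemidef {A B : Matrix n n ℂ} (hA : A.PosSemidef)
    (hB : B.PosSemidef) : 0 ≤ (A * B).trace.re := by
  obtain ⟨C, rfl⟩ := CStarAlgebra.nonneg_iff_eq_star_mul_self.mp
    (Matrix.nonneg_iff_posSemidef.mpr hA)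
  rw [Matrix.mul_assoc, Matrix.trace_mul_comm]
  exact (Complex.le_def.mp (hB.mul_mul_conjTranspose_same C).trace_nonneg).1

/-- A Hermitian unitary `S` satisfies `-1 ≤ S ≤ 1`. -/
theorem posSemidef_one_add_of_mul_self {S : Matrix n n ℂ} (hS : S.IsHermitian) (hS2 : S * S = 1) :
    (1 + S).PosSemidef := by
  have : 1 + S = (1 / 2 : ℝ) • ((1 + S)ᴴ * (1 + S)) := by
    rw [conjTranspose_add, hS.eq, conjTranspose_one, add_mul, mul_add, mul_add, hS2]
    simp only [one_mul, mul_one]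
    module
  rw [this]
  exact (posSemidef_conjTranspose_mul_self _).smul (by norm_num)

theorem trace_mul_le_of_mul_self {S X : Matrix n n ℂ} (hS : S.IsHermitian) (hS2 : S * S = 1)
    (hX : X.PosSemidef) : |(S * X).trace.re| ≤ X.trace.re := by
  have h1 := trace_mul_nonneg_of_posSemidef (posSemidef_one_add_of_mul_self hS hS2) hX
  have h2 := trace_mul_nonneg_of_posSemidef
    (posSemidef_one_add_of_mul_self (S := -S) hS.neg (by simpa using hS2)) hX
  simp only [add_mul, one_mul, trace_add, Complex.add_re, neg_mul, trace_neg,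
    Complex.neg_re] at h1 h2
  rw [abs_le]; constructor <;> linarith

end MatrixFacts

/-! ### The superoperator `J_σ`: Cauchy–Schwarz, range and injectivity. -/

section Lyap

variable {n : Type*} [Fintype n] [DecidableEq n]

/-- `J_σ` as a linear map. -/
noncomputable def lyapLin (σ : Matrix n n ℂ) : Matrix n n ℂ →ₗ[ℂ] Matrix n n ℂ where
  toFun := lyap σ
  map_add' X Y := by simp only [lyap, mul_add, add_mul]; module
  map_smul' c X := by simp only [lyap, Matrix.mul_smul, Matrix.smul_mul, RingHom.id_apply]; module

@[simp] theorem lyapLin_apply (σ X : Matrix n n ℂ) : lyapLin σ X = lyap σ X := rfl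

theorem conjTranspose_lyap {σ : Matrix n n ℂ} (hσ : σ.IsHermitian) (X : Matrix n n ℂ) :
    (lyap σ X)ᴴ = lyap σ Xᴴ := by
  simp only [lyap, conjTranspose_smul, conjTranspose_add, conjTranspose_mul, hσ.eq]
  rw [add_comm]; simp

theorem IsHermitian.lyap {σ X : Matrix n n ℂ} (hσ : σ.IsHermitian) (hX : X.IsHermitian) :
    (lyap σ X).IsHermitian := by
  rw [IsHermitian, conjTranspose_lyap hσ, hX.eq]

theorem trace_lyap_mul (σ X Y : Matrix n n ℂ) : (lyap σ X * Y).trace = (X * lyap σ Y).trace := by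
  simp only [lyap, Matrix.smul_mul, Matrix.mul_smul, trace_smul, add_mul, mul_add, trace_add]
  rw [Matrix.mul_assoc σ X Y, Matrix.trace_mul_comm σ (X * Y), Matrix.mul_assoc X Y σ,
    Matrix.mul_assoc X σ Y, add_comm]

/-- Used at a Hermitian unitary, where it gives `Tr σ`, and at the dual operator `Z`, where it
yields the quadratic term of the linearised divergence. -/
theorem trace_mul_lyap_self (σ X : Matrix n n ℂ) :
    (X * lyap σ X).trace = (σ * (X * X)).trace := by
  simp only [lyap, Matrix.mul_smul, trace_smul, mul_add, trace_add]
  rw [Matrix.trace_mul_comm X (σ * X), ← Matrix.mul_assoc X X σ, Matrix.trace_mul_comm (X * X) σ,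
    Matrix.mul_assoc σ X X, smul_eq_mul]
  ring

theorem trace_mul_lyap_self_nonneg {σ X : Matrix n n ℂ} (hσ : σ.PosSemidef) (hX : X.IsHermitian) :
    0 ≤ (X * lyap σ X).trace.re := by
  rw [trace_mul_lyap_self]
  refine trace_mul_nonneg_of_posSemidef hσ ?_
  simpa only [hX.eq] using posSemidef_conjTranspose_mul_self X

/-- Cauchy–Schwarz for the form `(X, Y) ↦ Tr X J_σ(Y)` on Hermitian matrices. -/
theorem trace_mul_lyap_sq_le {σ X Y : Matrix n n ℂ} (hσ : σ.PosSemidef) (hX : X.IsHermitian)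
    (hY : Y.IsHermitian) :
    (X * lyap σ Y).trace.re ^ 2 ≤ (X * lyap σ X).trace.re * (Y * lyap σ Y).trace.re := by
  have key : ∀ t : ℝ, 0 ≤ (X * lyap σ X).trace.re * (t * t) + (2 * (X * lyap σ Y).trace.re) * t +
      (Y * lyap σ Y).trace.re := by
    intro t
    have h := trace_mul_lyap_self_nonneg hσ (X := (t : ℂ) • X + Y)
      ((hX.smul (by simp [isSelfAdjoint_iff])).add hY)
    have e : lyap σ ((t : ℂ) • X + Y) = (t : ℂ) • lyap σ X + lyap σ Y := by
      simpa using (lyapLin σ).map_add ((t : ℂ) • X) Y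
    have e2 : (Y * lyap σ X).trace = (X * lyap σ Y).trace := by
      rw [← trace_lyap_mul, Matrix.trace_mul_comm]
    rw [e] at h
    simp only [add_mul, mul_add, trace_add, Matrix.smul_mul, Matrix.mul_smul, trace_smul, e2,
      Complex.add_re, smul_eq_mul, Complex.re_ofReal_mul] at h
    linarith
  have := discrim_le_zero key
  rw [discrim] at this
  nlinarith

/-- Cauchy–Schwarz with first factor `Tr S J_σ(S) = Tr σ S² = Tr σ`. With `S` the sign of `J_σ(Z)`
it bounds the trace norm by the Bures norm without inverting `σ`. -/
theorem trace_mul_le_sqrt {σ S Z : Matrix n n ℂ} (hσ : σ.PosSemidef) (hS : S.IsHermitian)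
    (hS2 : S * S = 1) (hZ : Z.IsHermitian) :
    (S * lyap σ Z).trace.re ≤ Real.sqrt (σ.trace.re * (lyap σ Z * Z).trace.re) := by
  refine Real.le_sqrt_of_sq_le ?_
  have := trace_mul_lyap_sq_le hσ hS hZ
  rwa [trace_mul_lyap_self σ S, hS2, mul_one, Matrix.trace_mul_comm Z] at this

/-- `J_σ` is self-adjoint for the Hilbert–Schmidt product, so the squared norm of `J_σ(X)` pairs `X`
with `J_σ²(X)`. -/
theorem lyap_eq_zero_of_lyap_lyap {σ X : Matrix n n ℂ} (hσ : σ.IsHermitian)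
    (h : lyap σ (lyap σ X) = 0) : lyap σ X = 0 := by
  rw [← trace_conjTranspose_mul_self_eq_zero_iff, conjTranspose_lyap hσ, trace_lyap_mul, h,
    mul_zero, trace_zero]

/-- The range of `J_σ` on Hermitian matrices is `J_σ` of the range. -/
theorem exists_mem_lyapRange_lyap_eq {σ X : Matrix n n ℂ} (hσ : σ.IsHermitian)
    (hX : X ∈ lyapRange σ) : ∃ Z ∈ lyapRange σ, lyap σ Z = X := by
  obtain ⟨W, hW, rfl⟩ := hX
  have hker : LinearMap.ker (lyapLin σ ∘ₗ lyapLin σ) = LinearMap.ker (lyapLin σ) := by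
    ext A
    simp only [LinearMap.mem_ker, LinearMap.comp_apply, lyapLin_apply]
    refine ⟨lyap_eq_zero_of_lyap_lyap hσ, fun h => ?_⟩
    rw [h]; exact (lyapLin σ).map_zero
  -- Equal kernels and rank–nullity.
  have hrange : LinearMap.range (lyapLin σ ∘ₗ lyapLin σ) = LinearMap.range (lyapLin σ) := by
    refine Submodule.eq_of_le_of_finrank_eq (LinearMap.range_comp_le_range _ _) ?_
    have h1 := (lyapLin σ ∘ₗ lyapLin σ).finrank_range_add_finrank_ker
    have h2 := (lyapLin σ).finrank_range_add_finrank_ker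
    rw [hker] at h1
    omega
  have hmem : lyap σ W ∈ LinearMap.range (lyapLin σ ∘ₗ lyapLin σ) := by
    rw [hrange]; exact ⟨W, rfl⟩
  obtain ⟨V, hV⟩ := hmem
  have hV : lyap σ (lyap σ V) = lyap σ W := hV
  have hV' : lyap σ (lyap σ Vᴴ) = lyap σ W := by
    rw [← conjTranspose_lyap hσ, ← conjTranspose_lyap hσ, hV, (IsHermitian.lyap hσ hW).eq]
  -- The dimension count is over `ℂ`, so `V` need not be Hermitian; its Hermitian part has the same
  -- image under `J_σ²`, because the target is Hermitian.
  refine ⟨lyap σ ((1 / 2 : ℂ) • (V + Vᴴ)), ⟨_, ?_, rfl⟩, ?_⟩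
  · simp only [Set.mem_ofPred_eq, IsHermitian, conjTranspose_smul, conjTranspose_add,
      conjTranspose_conjTranspose]
    rw [add_comm]; simp
  · have : lyap σ (lyap σ ((1 / 2 : ℂ) • (V + Vᴴ))) =
        (1 / 2 : ℂ) • (lyap σ (lyap σ V) + lyap σ (lyap σ Vᴴ)) := by
      simp only [← lyapLin_apply, map_smul, map_add]
    rw [this, hV, hV']
    module

theorem lyapInv_spec {σ X : Matrix n n ℂ} (hσ : σ.IsHermitian) (hX : X ∈ lyapRange σ) :
    (lyapInv σ X).IsHermitian ∧ lyap σ (lyapInv σ X) = X := by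
  have h : ∃ Z ∈ lyapRange σ, lyap σ Z = X := exists_mem_lyapRange_lyap_eq hσ hX
  refine ⟨?_, Function.invFunOn_eq h⟩
  obtain ⟨W, hW, hWe⟩ := Function.invFunOn_mem h
  rw [lyapInv, ← hWe]
  exact IsHermitian.lyap hσ hW

/-- With `σ = C†C`, pairing `σZ + Zσ = 0` with `Z†` gives `‖CZ‖² + ‖CZ†‖² = 0` in Hilbert–Schmidt
norm; hence `σZ = 0`. -/
theorem lyap_injective {σ : Matrix n n ℂ} (hσ : σ.PosDef) : Function.Injective (lyapLin σ) := by
  rw [← LinearMap.ker_eq_bot, LinearMap.ker_eq_bot']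
  intro Z hZ
  obtain ⟨C, hC⟩ := CStarAlgebra.nonneg_iff_eq_star_mul_self.mp
    (Matrix.nonneg_iff_posSemidef.mpr hσ.posSemidef)
  have h1 : ((C * Z)ᴴ * (C * Z)).trace = (Zᴴ * (σ * Z)).trace := by
    rw [hC, conjTranspose_mul, star_eq_conjTranspose]; simp only [Matrix.mul_assoc]
  have h2 : ((C * Zᴴ)ᴴ * (C * Zᴴ)).trace = (Zᴴ * (Z * σ)).trace := by
    rw [hC, conjTranspose_mul, star_eq_conjTranspose, conjTranspose_conjTranspose,
      Matrix.trace_mul_comm, ← Matrix.mul_assoc Zᴴ, Matrix.trace_mul_comm (Zᴴ * Z),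
      Matrix.mul_assoc C, ← Matrix.mul_assoc Zᴴ, Matrix.trace_mul_comm C]
    rw [Matrix.mul_assoc, Matrix.trace_mul_comm]
  have h3 : ((C * Z)ᴴ * (C * Z)).trace + ((C * Zᴴ)ᴴ * (C * Zᴴ)).trace = 0 := by
    rw [h1, h2, ← trace_add, ← mul_add]
    have : σ * Z + Z * σ = 0 := by
      have h := congrArg (fun A => (2 : ℂ) • A) hZ
      simpa [lyap, smul_smul] using h
    rw [this, mul_zero, trace_zero]
  have h4 := (posSemidef_conjTranspose_mul_self (C * Z)).trace_nonneg
  have h5 := (posSemidef_conjTranspose_mul_self (C * Zᴴ)).trace_nonneg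
  have h6 : ((C * Z)ᴴ * (C * Z)).trace = 0 :=
    ((add_eq_zero_iff_of_nonneg h4 h5).mp h3).1
  have h7 : C * Z = 0 := trace_conjTranspose_mul_self_eq_zero_iff.mp h6
  have h8 : σ * Z = 0 := by rw [hC, Matrix.mul_assoc, h7, mul_zero]
  have := hσ.isUnit
  exact (this.mul_right_eq_zero).mp h8

end Lyap

/-! ### The commutant of `V ⊗ V`. -/

section Commutant

variable {n : Type*} [Fintype n] [DecidableEq n]

/-- `A ↦ T (A ⊗ 1 + 1 ⊗ A) - (A ⊗ 1 + 1 ⊗ A) T`. -/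
noncomputable def derivationCommutator (T : Matrix (n × n) (n × n) ℂ) :
    Matrix n n ℂ →ₗ[ℂ] Matrix (n × n) (n × n) ℂ where
  toFun A := T * (A ⊗ₖ 1 + 1 ⊗ₖ A) - (A ⊗ₖ 1 + 1 ⊗ₖ A) * T
  map_add' A B := by simp only [add_kronecker, kronecker_add, mul_add, add_mul]; abel
  map_smul' c A := by
    simp only [smul_kronecker, kronecker_smul, mul_add, add_mul, Matrix.mul_smul, Matrix.smul_mul,
      RingHom.id_apply]
    module

variable {T : Matrix (n × n) (n × n) ℂ}

/-- No differentiation is needed: with `P = vv†` and `N = ‖v‖²`, the matrix `1 + (w/N)P` is unitary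
whenever `|1 + w| = 1`. Commutation with its tensor square has a part linear and a part quadratic in
`w`; two values of `w` separate them. -/
theorem derivationCommutator_vecMulVec
    (hT : ∀ V : unitaryGroup n ℂ, ((V : Matrix n n ℂ) ⊗ₖ (V : Matrix n n ℂ)) * T =
      T * ((V : Matrix n n ℂ) ⊗ₖ (V : Matrix n n ℂ))) (v : n → ℂ) :
    derivationCommutator T (vecMulVec v (star v)) = 0 := by
  by_cases hv : v = 0
  · simp [hv]
  set P := vecMulVec v (star v) with hP
  obtain ⟨N, hN, hN0⟩ : ∃ N : ℝ, star v ⬝ᵥ v = (N : ℂ) ∧ N ≠ 0 := by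
    have h0 : 0 ≤ star v ⬝ᵥ v := by simp
    obtain ⟨h1, h2⟩ := Complex.le_def.mp h0
    have h3 : star v ⬝ᵥ v = ((star v ⬝ᵥ v).re : ℂ) :=
      Complex.ext (by simp) (h2.symm.trans (by simp))
    refine ⟨_, h3, fun h => hv ?_⟩
    rw [h] at h3
    exact dotProduct_star_self_eq_zero.mp (by rw [dotProduct_comm]; simpa using h3)
  have hPP : P * P = (N : ℂ) • P := by
    rw [hP, vecMulVec_mul_vecMulVec, hN, vecMulVec_smul]
  have hPH : Pᴴ = P := by
    rw [hP, conjTranspose_vecMulVec, star_star]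
  have hNC : (N : ℂ) ≠ 0 := by exact_mod_cast hN0
  -- The condition on `w` is `|1 + w|² = 1`. The common factor `w/N` has been divided out.
  have key : ∀ w : ℂ, w ≠ 0 → w + star w + w * star w = 0 →
      derivationCommutator T P + (w / N) • (T * (P ⊗ₖ P) - (P ⊗ₖ P) * T) = 0 := by
    intro w hw hw2
    have hV : (1 + (w / N) • P) ∈ unitaryGroup n ℂ := by
      rw [mem_unitaryGroup_iff, star_eq_conjTranspose, conjTranspose_add, conjTranspose_smul, hPH,
        conjTranspose_one]
      simp only [mul_add, add_mul, mul_one, one_mul, Matrix.smul_mul, Matrix.mul_smul, hPP,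
        smul_smul]
      have hst : star (w / (N : ℂ)) = star w / N := by simp
      rw [hst, add_assoc, ← add_smul, ← add_smul]
      have : w / N + (star w / N + star w / N * (w / N * N)) = 0 := by
        field_simp
        linear_combination hw2
      rw [this, zero_smul, add_zero]
    have h := hT ⟨_, hV⟩
    simp only [add_kronecker, kronecker_add, one_kronecker_one, smul_kronecker, kronecker_smul,
      add_mul, mul_add, one_mul, mul_one, Matrix.smul_mul, Matrix.mul_smul] at h
    have hwN : w / N ≠ 0 := div_ne_zero hw hNC
    have h2 : (w / N) • (derivationCommutator T P +
        (w / N) • (T * (P ⊗ₖ P) - (P ⊗ₖ P) * T)) = 0 := by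
      simp only [derivationCommutator, LinearMap.coe_mk, AddHom.coe_mk, mul_add, add_mul]
      have h' := sub_eq_zero.mpr h.symm
      rw [← h']
      module
    exact (smul_eq_zero.mp h2).resolve_left hwN
  -- The two phases are `1 + w = -1` and `1 + w = i`.
  have k1 := key (-2) (by norm_num) (by simp; norm_num)
  have k2 := key (Complex.I - 1) (by
    intro h
    have := congrArg Complex.im h
    simp at this) (by
    simp only [star_sub, star_one, Complex.star_def, Complex.conj_I]
    linear_combination -Complex.I_mul_I)
  have hC : T * (P ⊗ₖ P) - (P ⊗ₖ P) * T = 0 := by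
    have h3 : ((-2 / N : ℂ) - (Complex.I - 1) / N) • (T * (P ⊗ₖ P) - (P ⊗ₖ P) * T) = 0 := by
      rw [sub_smul]
      have := congrArg₂ (· - ·) k1 k2
      simpa using this
    refine (smul_eq_zero.mp h3).resolve_left ?_
    rw [← sub_div]
    refine div_ne_zero (fun h => ?_) hNC
    have := congrArg Complex.im h
    simp at this
  rw [hC, smul_zero, add_zero] at k1
  exact k1

/-- Polarisation: the rank-one cases `e_x + e_y` and `e_x + i e_y` isolate the matrix unit, by
complex linearity. -/
theorem derivationCommutator_single
    (hT : ∀ V : unitaryGroup n ℂ, ((V : Matrix n n ℂ) ⊗ₖ (V : Matrix n n ℂ)) * T =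
      T * ((V : Matrix n n ℂ) ⊗ₖ (V : Matrix n n ℂ))) (x y : n) :
    derivationCommutator T (single x y 1) = 0 := by
  have hx := derivationCommutator_vecMulVec hT (Pi.single x 1)
  have hy := derivationCommutator_vecMulVec hT (Pi.single y 1)
  have h1 := derivationCommutator_vecMulVec hT (Pi.single x 1 + Pi.single y 1)
  have h2 := derivationCommutator_vecMulVec hT (Pi.single x 1 + Complex.I • Pi.single y 1)
  have hs : ∀ z : n, star (Pi.single z 1 : n → ℂ) = Pi.single z 1 := fun z => by
    rw [← Pi.single_star, star_one]
  simp only [star_add, star_smul, hs, vecMulVec_add, add_vecMulVec, smul_vecMulVec,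
    vecMulVec_smul, map_add, map_smul] at hx hy h1 h2
  have e : single x y (1 : ℂ) = vecMulVec (Pi.single x 1) (Pi.single y 1) := by
    ext i j
    simp only [single_apply, vecMulVec_apply, Pi.single_apply, eq_comm (a := x), eq_comm (a := y)]
    by_cases hi : i = x <;> by_cases hj : j = y <;> simp [hi, hj]
  rw [e]
  rw [hx, hy] at h1 h2
  simp only [zero_add, add_zero, smul_zero, Complex.star_def, Complex.conj_I] at h1 h2
  have h1' := eq_neg_of_add_eq_zero_left h1
  rw [h1'] at h2
  have h3 : (2 * Complex.I) • (derivationCommutator T)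
      (vecMulVec (Pi.single x 1) (Pi.single y 1)) = 0 := by
    rw [← neg_eq_zero, ← h2]
    module
  exact (smul_eq_zero.mp h3).resolve_left (by simp)

theorem commutant_entry_relation
    (hT : ∀ V : unitaryGroup n ℂ, ((V : Matrix n n ℂ) ⊗ₖ (V : Matrix n n ℂ)) * T =
      T * ((V : Matrix n n ℂ) ⊗ₖ (V : Matrix n n ℂ))) (x y p q r s : n) :
    (if p = x then T (y, q) (r, s) else 0) + (if q = x then T (p, y) (r, s) else 0) =
      (if y = r then T (p, q) (x, s) else 0) + (if y = s then T (p, q) (r, x) else 0) := by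
  have h := congrFun (congrFun (derivationCommutator_single hT x y) (p, q)) (r, s)
  simp only [derivationCommutator, LinearMap.coe_mk, AddHom.coe_mk, Matrix.sub_apply, mul_apply,
    Fintype.sum_prod_type, Matrix.add_apply, kronecker_apply, single_apply, one_apply, Matrix.zero_apply] at h
  have h := (sub_eq_zero.mp h).symm
  simp only [mul_add, add_mul, Finset.sum_add_distrib] at h
  simp only [ite_and, ite_mul, mul_ite, mul_one, one_mul, mul_zero, zero_mul,
    Finset.sum_ite_eq, Finset.sum_ite_eq', Finset.mem_univ, if_true, Finset.sum_ite_irrel,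
    Finset.sum_const_zero] at h
  simpa [eq_comm] using h

/-- An operator in the commutant of `V ⊗ V` whose first partial trace vanishes is a multiple of
`d F - 1`, where `F` is the swap. -/
theorem commutant_entry_eq
    (hT : ∀ V : unitaryGroup n ℂ, ((V : Matrix n n ℂ) ⊗ₖ (V : Matrix n n ℂ)) * T =
      T * ((V : Matrix n n ℂ) ⊗ₖ (V : Matrix n n ℂ)))
    (hA : ∀ q s, ∑ p, T (p, q) (p, s) = 0) (y q r s : n) :
    (Fintype.card n : ℂ) * ((Fintype.card n : ℂ) ^ 2 - 1) * T (y, q) (r, s) =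
      (∑ p, ∑ p', T (p, p') (p', p)) *
        ((Fintype.card n : ℂ) * ((if y = s then 1 else 0) * (if q = r then 1 else 0)) -
          (if q = s then 1 else 0) * (if y = r then 1 else 0)) := by
  have rel := commutant_entry_relation hT
  set d : ℂ := (Fintype.card n : ℂ) with hd
  set B : n → n → ℂ := fun q r => ∑ p, T (p, q) (r, p) with hB
  -- Set `p = x` and sum over `x`; the vanishing partial trace removes one term.
  have h1 : ∀ y q r s, d * T (y, q) (r, s) + T (q, y) (r, s) = (if y = s then 1 else 0) * B q r := by
    intro y q r s
    have := Finset.sum_congr rfl fun x (_ : x ∈ Finset.univ) => rel x y x q r s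
    simpa [Finset.sum_add_distrib, Finset.sum_ite_irrel, hA, hB, hd] using this
  -- Set `s = p` and sum over `p`: the other partial trace `B` commutes with all matrix units, hence
  -- is scalar.
  have h2 : ∀ x y q r, (if q = x then B y r else 0) = if y = r then B q x else 0 := by
    intro x y q r
    have := Finset.sum_congr rfl fun p (_ : p ∈ Finset.univ) => rel x y p q r p
    simp only [Finset.sum_add_distrib, Finset.sum_ite_irrel, Finset.sum_ite_eq,
      Finset.sum_ite_eq', Finset.mem_univ, if_true, Finset.sum_const_zero] at this
    rw [add_comm] at this
    exact add_right_cancel this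
  have h3 : ∀ q r, d * B q r = (∑ p, ∑ p', T (p, p') (p', p)) * (if q = r then 1 else 0) := by
    intro q r
    have := Finset.sum_congr rfl fun x (_ : x ∈ Finset.univ) => h2 x q x r
    have e : ∑ x, B x x = ∑ p, ∑ p', T (p, p') (p', p) := Finset.sum_comm
    rw [← e]
    simpa [Finset.sum_ite_irrel, hd] using this
  -- Eliminating `T (q, y) (r, s)` between `h1` and its copy with `y` and `q` exchanged produces the
  -- factor `d² - 1`.
  linear_combination d * d * h1 y q r s - d * h1 q y r s +
    d * (if y = s then 1 else 0) * h3 q r - (if q = s then 1 else 0) * h3 y r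

end Commutant

/-! ### Second moments of the Haar measure and of 2-designs. -/

section Twirl

variable {n : Type*} [Fintype n] [DecidableEq n]

theorem integrable_of_continuous_unitaryGroup {E : Type*} [NormedAddCommGroup E]
    (ν : Measure (unitaryGroup n ℂ)) [IsFiniteMeasure ν] {f : unitaryGroup n ℂ → E}
    (hf : Continuous f) : Integrable f ν :=
  hf.integrable_of_hasCompactSupport (HasCompactSupport.of_compactSpace f)

theorem continuous_twofoldConj (M : Matrix (n × n) (n × n) ℂ) :
    Continuous (twofoldConj M) := by
  have h : Continuous fun U : unitaryGroup n ℂ => (U : Matrix n n ℂ) := continuous_subtype_val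
  have hk : ∀ {f g : unitaryGroup n ℂ → Matrix n n ℂ}, Continuous f → Continuous g →
      Continuous fun U => f U ⊗ₖ g U := fun hf hg =>
    continuous_matrix fun i j => (hf.matrix_elem i.1 j.1).mul (hg.matrix_elem i.2 j.2)
  exact ((hk h h).matrix_mul continuous_const).matrix_mul
    (hk h.matrix_conjTranspose h.matrix_conjTranspose)

instance : IsProbabilityMeasure (haarUnitary n) := ⟨Measure.haarMeasure_self⟩

/-- The second-moment twirl over the Haar measure. -/
noncomputable def haarTwirl (M : Matrix (n × n) (n × n) ℂ) : Matrix (n × n) (n × n) ℂ :=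
  Matrix.of fun i j => ∫ U, twofoldConj M U i j ∂(haarUnitary n)

theorem integral_mul_mul_apply (ν : Measure (unitaryGroup n ℂ)) [IsFiniteMeasure ν]
    {m : Type*} [Fintype m] {F : unitaryGroup n ℂ → Matrix m m ℂ} (hF : Continuous F)
    (A B : Matrix m m ℂ) (i j : m) :
    ∫ U, (A * F U * B) i j ∂ν = (A * (Matrix.of fun i j => ∫ U, F U i j ∂ν) * B) i j := by
  simp only [mul_apply, of_apply]
  have hint : ∀ k l, Integrable (fun U => A i k * F U k l * B l j) ν := fun k l =>
    integrable_of_continuous_unitaryGroup ν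
      ((continuous_const.mul (hF.matrix_elem k l)).mul continuous_const)
  simp only [Finset.sum_mul]
  rw [integral_finsetSum _ fun l _ => integrable_finsetSum _ fun k _ => hint k l]
  refine Finset.sum_congr rfl fun l _ => ?_
  rw [integral_finsetSum _ fun k _ => hint k l]
  refine Finset.sum_congr rfl fun k _ => ?_
  rw [integral_mul_const, integral_const_mul]

/-- Left invariance: the substitution `U ↦ VU` conjugates the twirl by `V ⊗ V`. -/
theorem kronecker_self_mul_haarTwirl (M : Matrix (n × n) (n × n) ℂ) (V : unitaryGroup n ℂ) :
    ((V : Matrix n n ℂ) ⊗ₖ (V : Matrix n n ℂ)) * haarTwirl M =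
      haarTwirl M * ((V : Matrix n n ℂ) ⊗ₖ (V : Matrix n n ℂ)) := by
  have hVV : (V : Matrix n n ℂ)ᴴ * (V : Matrix n n ℂ) = 1 := mem_unitaryGroup_iff'.mp V.2
  have h : ((V : Matrix n n ℂ) ⊗ₖ (V : Matrix n n ℂ)) * haarTwirl M *
      ((V : Matrix n n ℂ)ᴴ ⊗ₖ (V : Matrix n n ℂ)ᴴ) = haarTwirl M := by
    ext i j
    rw [haarTwirl, ← integral_mul_mul_apply _ (continuous_twofoldConj M), of_apply]
    have : (haarUnitary n).IsMulLeftInvariant := by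
      unfold haarUnitary; infer_instance
    rw [← integral_mul_left_eq_self (fun U => twofoldConj M U i j) V]
    congr 1
    funext U
    simp only [twofoldConj, Submonoid.coe_mul, conjTranspose_mul, mul_kronecker_mul,
      Matrix.mul_assoc]
  calc _ = ((V : Matrix n n ℂ) ⊗ₖ (V : Matrix n n ℂ)) * haarTwirl M *
      (((V : Matrix n n ℂ)ᴴ ⊗ₖ (V : Matrix n n ℂ)ᴴ) *
        ((V : Matrix n n ℂ) ⊗ₖ (V : Matrix n n ℂ))) := by
        rw [← mul_kronecker_mul, hVV, one_kronecker_one, mul_one]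
    _ = _ := by rw [← Matrix.mul_assoc, h]

theorem twofoldConj_kronecker_apply (M N : Matrix n n ℂ) (U : unitaryGroup n ℂ) (p q r s : n) :
    twofoldConj (M ⊗ₖ N) U (p, q) (r, s) =
      ((U : Matrix n n ℂ) * M * (U : Matrix n n ℂ)ᴴ) p r *
        ((U : Matrix n n ℂ) * N * (U : Matrix n n ℂ)ᴴ) q s := by
  rw [twofoldConj, ← mul_kronecker_mul, ← mul_kronecker_mul, kronecker_apply]

theorem trace_unitary_conj (M : Matrix n n ℂ) (U : unitaryGroup n ℂ) :
    ((U : Matrix n n ℂ) * M * (U : Matrix n n ℂ)ᴴ).trace = M.trace := by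
  have hUU : (U : Matrix n n ℂ)ᴴ * (U : Matrix n n ℂ) = 1 := mem_unitaryGroup_iff'.mp U.2
  rw [Matrix.trace_mul_comm, ← Matrix.mul_assoc, hUU, one_mul]

theorem integrable_twofoldConj (ν : Measure (unitaryGroup n ℂ)) [IsFiniteMeasure ν]
    (M : Matrix (n × n) (n × n) ℂ) (i j : n × n) :
    Integrable (fun U => twofoldConj M U i j) ν :=
  integrable_of_continuous_unitaryGroup ν ((continuous_twofoldConj M).matrix_elem i j)

theorem haarTwirl_kronecker_partialTrace {M : Matrix n n ℂ} (hM : M.trace = 0) (N : Matrix n n ℂ)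
    (q s : n) : ∑ p, haarTwirl (M ⊗ₖ N) (p, q) (p, s) = 0 := by
  simp only [haarTwirl, of_apply]
  rw [← integral_finsetSum _ fun p _ => integrable_twofoldConj _ _ _ _]
  refine integral_eq_zero_of_ae (Filter.Eventually.of_forall fun U => ?_)
  simp only [twofoldConj_kronecker_apply, ← Finset.sum_mul, Pi.zero_apply]
  have := trace_unitary_conj M U
  rw [hM, trace] at this
  simp only [diag_apply] at this
  rw [this, zero_mul]

/-- For every `U` the contraction is `Tr(UMU† UNU†)`, which does not depend on `U`. It fixes the one
free constant in `commutant_entry_eq`. -/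
theorem haarTwirl_kronecker_swapTrace (M N : Matrix n n ℂ) :
    ∑ p, ∑ q, haarTwirl (M ⊗ₖ N) (p, q) (q, p) = (M * N).trace := by
  simp only [haarTwirl, of_apply]
  have h1 : ∀ p, ∑ q, ∫ U, twofoldConj (M ⊗ₖ N) U (p, q) (q, p) ∂(haarUnitary n) =
      ∫ U, ∑ q, twofoldConj (M ⊗ₖ N) U (p, q) (q, p) ∂(haarUnitary n) := fun p =>
    (integral_finsetSum _ fun q _ => integrable_twofoldConj _ _ _ _).symm
  simp only [h1]
  rw [← integral_finsetSum _ fun p _ =>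
    integrable_finsetSum _ fun q _ => integrable_twofoldConj _ _ _ _]
  have h2 : ∀ U : unitaryGroup n ℂ, ∑ p, ∑ q, twofoldConj (M ⊗ₖ N) U (p, q) (q, p) =
      (M * N).trace := by
    intro U
    have hUU : (U : Matrix n n ℂ)ᴴ * (U : Matrix n n ℂ) = 1 := mem_unitaryGroup_iff'.mp U.2
    rw [← trace_unitary_conj (M * N) U]
    have : (U : Matrix n n ℂ) * (M * N) * (U : Matrix n n ℂ)ᴴ =
        ((U : Matrix n n ℂ) * M * (U : Matrix n n ℂ)ᴴ) *
          ((U : Matrix n n ℂ) * N * (U : Matrix n n ℂ)ᴴ) := by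
      calc _ = (U : Matrix n n ℂ) * M * 1 * N * (U : Matrix n n ℂ)ᴴ := by
            simp only [Matrix.mul_assoc, mul_one]
        _ = _ := by rw [← hUU]; simp only [Matrix.mul_assoc]
    rw [this]
    simp only [twofoldConj_kronecker_apply, trace, diag_apply, mul_apply (M := (U : Matrix n n ℂ) * M * (U : Matrix n n ℂ)ᴴ)]
  simp only [h2, integral_const, probReal_univ, one_smul]

/-- The second moments of a 2-design on `M ⊗ N` with `M` traceless. -/
theorem IsUnitaryTwoDesign.integral_twofoldConj {ν : Measure (unitaryGroup n ℂ)}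
    (hν : IsUnitaryTwoDesign ν) {M : Matrix n n ℂ} (hM : M.trace = 0) (N : Matrix n n ℂ)
    (p q r s : n) :
    (Fintype.card n : ℂ) * ((Fintype.card n : ℂ) ^ 2 - 1) *
        ∫ U, twofoldConj (M ⊗ₖ N) U (p, q) (r, s) ∂ν =
      (M * N).trace *
        ((Fintype.card n : ℂ) * ((if p = s then 1 else 0) * (if q = r then 1 else 0)) -
          (if q = s then 1 else 0) * (if p = r then 1 else 0)) := by
  rw [hν.2, ← haarTwirl_kronecker_swapTrace]
  exact commutant_entry_eq (kronecker_self_mul_haarTwirl _)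
    (haarTwirl_kronecker_partialTrace hM N) p q r s

end Twirl

/-! ### The contraction factor of the partial trace. -/

section PartialTrace

variable {a₁ a₂ e : Type*} [Fintype a₁] [DecidableEq a₁] [Fintype a₂] [DecidableEq a₂]
  [Fintype e] [DecidableEq e]

/-- The average contraction of the Hilbert–Schmidt form under `Tr_{A₂}` of a 2-design. -/
noncomputable def designFactor (a₁ a₂ : Type*) [Fintype a₁] [Fintype a₂] : ℝ :=
  (Fintype.card a₂ : ℝ) * ((Fintype.card a₁ : ℝ) ^ 2 - 1) /
    ((Fintype.card (a₁ × a₂) : ℝ) ^ 2 - 1)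

/-- In the index pattern of a product of two partial traces, the swap forces `k = l` and leaves
`|A₁|²|A₂|` terms; the identity forces `i = j` and leaves `|A₁||A₂|²`. -/
theorem sum_partialTrace_kronecker (d : ℂ) :
    ∑ i : a₁, ∑ j : a₁, ∑ k : a₂, ∑ l : a₂,
      (d * ((if ((i, k) : a₁ × a₂) = (i, l) then (1 : ℂ) else 0) *
          (if ((j, l) : a₁ × a₂) = (j, k) then 1 else 0)) -
        (if ((j, l) : a₁ × a₂) = (i, l) then 1 else 0) *
          (if ((i, k) : a₁ × a₂) = (j, k) then 1 else 0)) =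
      d * (Fintype.card a₁ : ℂ) ^ 2 * Fintype.card a₂ -
        (Fintype.card a₁ : ℂ) * (Fintype.card a₂ : ℂ) ^ 2 := by
  have h1 : ∀ (k l : a₂), (if k = l then (1 : ℂ) else 0) * (if l = k then 1 else 0) =
      if k = l then 1 else 0 := fun k l => by by_cases h : k = l <;> simp [h]
  have h2 : ∀ (k l : a₁), (if k = l then (1 : ℂ) else 0) * (if l = k then 1 else 0) =
      if k = l then 1 else 0 := fun k l => by by_cases h : k = l <;> simp [h]
  simp only [Prod.mk.injEq, true_and, and_true, h1, h2]
  simp [Finset.sum_sub_distrib]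
  ring

theorem IsUnitaryTwoDesign.integral_partialTrace [Nonempty a₁] [Nonempty a₂]
    {ν : Measure (unitaryGroup (a₁ × a₂) ℂ)}
    (hν : IsUnitaryTwoDesign ν) {M : Matrix (a₁ × a₂) (a₁ × a₂) ℂ} (hM : M.trace = 0)
    (N : Matrix (a₁ × a₂) (a₁ × a₂) ℂ) :
    ∑ i : a₁, ∑ j : a₁, ∑ k : a₂, ∑ l : a₂,
        ∫ U, twofoldConj (M ⊗ₖ N) U ((i, k), (j, l)) ((j, k), (i, l)) ∂ν =
      (designFactor a₁ a₂ : ℂ) * (M * N).trace := by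
  -- Here `d² - 1 = 0` and the moment formula is empty, but a traceless 1×1 matrix vanishes.
  by_cases hd : Fintype.card (a₁ × a₂) = 1
  · have hM0 : M = 0 := by
      have : Subsingleton (a₁ × a₂) := (Fintype.card_le_one_iff_subsingleton).mp hd.le
      ext x y
      rw [trace, Fintype.sum_subsingleton _ x, diag_apply] at hM
      rw [Subsingleton.elim y x, hM, Matrix.zero_apply]
    subst hM0
    simp [twofoldConj]
  have hd2 : 1 < Fintype.card (a₁ × a₂) := by
    have := Fintype.card_pos (α := a₁ × a₂)
    omega
  set d : ℂ := (Fintype.card (a₁ × a₂) : ℂ) with hdd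
  have hdR : (1 : ℝ) < (Fintype.card (a₁ × a₂) : ℝ) := by exact_mod_cast hd2
  have hdne : (Fintype.card (a₁ × a₂) : ℝ) ^ 2 - 1 ≠ 0 := by nlinarith
  have hdC : d ^ 2 - 1 ≠ 0 := by rw [hdd]; exact_mod_cast hdne
  have hd0 : d ≠ 0 := by rw [hdd]; exact_mod_cast (by omega : Fintype.card (a₁ × a₂) ≠ 0)
  have key : d * (d ^ 2 - 1) * ∑ i : a₁, ∑ j : a₁, ∑ k : a₂, ∑ l : a₂,
      ∫ U, twofoldConj (M ⊗ₖ N) U ((i, k), (j, l)) ((j, k), (i, l)) ∂ν =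
      (M * N).trace * (d * (Fintype.card a₁ : ℂ) ^ 2 * Fintype.card a₂ -
        (Fintype.card a₁ : ℂ) * (Fintype.card a₂ : ℂ) ^ 2) := by
    rw [← sum_partialTrace_kronecker]
    simp only [Finset.mul_sum]
    refine Finset.sum_congr rfl fun i _ => Finset.sum_congr rfl fun j _ =>
      Finset.sum_congr rfl fun k _ => Finset.sum_congr rfl fun l _ => ?_
    exact hν.integral_twofoldConj hM N _ _ _ _
  have hprod : d = (Fintype.card a₁ : ℂ) * Fintype.card a₂ := by
    rw [hdd, Fintype.card_prod]; push_cast; rfl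
  refine mul_left_cancel₀ (mul_ne_zero hd0 hdC) (key.trans ?_)
  have hf : (designFactor a₁ a₂ : ℂ) = (Fintype.card a₂ : ℂ) * ((Fintype.card a₁ : ℂ) ^ 2 - 1) /
      (d ^ 2 - 1) := by
    rw [designFactor, hdd]; push_cast; rfl
  rw [hf]
  field_simp
  rw [hprod]
  ring

end PartialTrace

/-! ### Blocks over `E`, marginals and local unitaries. -/

section SystemFacts

variable {a e : Type*} [Fintype a] [DecidableEq a] [Fintype e] [DecidableEq e]

/-- The operator block of `X_{AE}` at a pair of basis vectors of `E`. -/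
def blockE (X : Matrix (a × e) (a × e) ℂ) (x y : e) : Matrix a a ℂ :=
  Matrix.of fun p q => X (p, x) (q, y)

theorem unitaryChannel_apply (U : unitaryGroup a ℂ) (X : Matrix (a × e) (a × e) ℂ)
    (p q : a) (x y : e) :
    unitaryChannel U X (p, x) (q, y) =
      ((U : Matrix a a ℂ) * blockE X x y * (U : Matrix a a ℂ)ᴴ) p q := by
  simp [unitaryChannel, mul_apply, Fintype.sum_prod_type, one_apply, blockE]

theorem trace_mul_eq_sum_blockE (X Y : Matrix (a × e) (a × e) ℂ) :
    (X * Y).trace = ∑ x, ∑ y, (blockE X x y * blockE Y y x).trace := by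
  simp only [trace, diag_apply, mul_apply, Fintype.sum_prod_type, blockE, of_apply]
  rw [Finset.sum_comm]
  refine Finset.sum_congr rfl fun x _ => ?_
  rw [Finset.sum_comm' (t' := Finset.univ) (s' := fun _ => Finset.univ) (by simp)]
  conv_rhs => rw [Finset.sum_comm]
  rw [Finset.sum_comm]
  refine Finset.sum_congr rfl fun p _ => ?_
  rw [Finset.sum_comm]

theorem trace_blockE (X : Matrix (a × e) (a × e) ℂ) (x y : e) :
    (blockE X x y).trace = marginalE X x y := rfl

theorem trace_marginalE (X : Matrix (a × e) (a × e) ℂ) : (marginalE X).trace = X.trace := by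
  simp only [trace, diag_apply, marginalE, of_apply, Fintype.sum_prod_type]
  exact Finset.sum_comm

theorem marginalE_sub (X Y : Matrix (a × e) (a × e) ℂ) :
    marginalE (X - Y) = marginalE X - marginalE Y := by
  ext i j; simp [marginalE, Finset.sum_sub_distrib]

theorem marginalE_kronecker_maxMixed [Nonempty a] (X : Matrix e e ℂ) :
    marginalE (maxMixed a ⊗ₖ X) = X := by
  ext i j
  have : (Fintype.card a : ℂ) ≠ 0 := by exact_mod_cast Fintype.card_ne_zero
  simp [marginalE, maxMixed]

/-- Multiplication by `1 ⊗ σ` passes through a trace over `A`. The same locality gives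
`unitaryChannel_lyap` and `traceA2_lyap`, which let the Bures structure survive the whole protocol.
-/
theorem marginalE_lyap (σ : Matrix e e ℂ) (Z : Matrix (a × e) (a × e) ℂ) :
    marginalE (lyap ((1 : Matrix a a ℂ) ⊗ₖ σ) Z) = lyap σ (marginalE Z) := by
  ext i j
  simp only [marginalE, lyap, of_apply, Matrix.smul_apply, Matrix.add_apply, mul_apply,
    Fintype.sum_prod_type, kronecker_apply, one_apply, smul_eq_mul, ← Finset.mul_sum,
    Finset.sum_add_distrib]
  congr 2
  · simp only [ite_mul, one_mul, zero_mul, Finset.sum_ite_irrel, Finset.sum_const_zero,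
      Finset.sum_ite_eq, Finset.mem_univ, if_true]
    rw [Finset.sum_comm]
    simp only [Finset.mul_sum]
  · simp only [ite_mul, mul_ite, one_mul, zero_mul, mul_zero, Finset.sum_ite_irrel,
      Finset.sum_const_zero, Finset.sum_ite_eq', Finset.mem_univ, if_true]
    rw [Finset.sum_comm]
    simp only [Finset.sum_mul]

theorem lyap_one_kronecker (σ : Matrix e e ℂ) (X : Matrix e e ℂ) :
    lyap ((1 : Matrix a a ℂ) ⊗ₖ σ) (maxMixed a ⊗ₖ X) = maxMixed a ⊗ₖ lyap σ X := by
  simp only [lyap, ← mul_kronecker_mul, one_mul, mul_one, kronecker_smul, kronecker_add]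

theorem trace_mul_maxMixed_kronecker (X : Matrix (a × e) (a × e) ℂ) (B : Matrix e e ℂ) :
    (X * (maxMixed a ⊗ₖ B)).trace = (Fintype.card a : ℂ)⁻¹ * (marginalE X * B).trace := by
  simp only [trace, diag_apply, mul_apply, Fintype.sum_prod_type, kronecker_apply, maxMixed,
    Matrix.smul_apply, one_apply, marginalE, of_apply, smul_eq_mul]
  simp only [mul_ite, ite_mul, mul_one, mul_zero, zero_mul, Finset.sum_ite_irrel,
    Finset.sum_const_zero, Finset.sum_ite_eq', Finset.mem_univ, if_true]
  rw [Finset.sum_comm, Finset.mul_sum]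
  refine Finset.sum_congr rfl fun x _ => ?_
  rw [Finset.sum_comm, Finset.mul_sum]
  refine Finset.sum_congr rfl fun y _ => ?_
  rw [Finset.sum_mul, Finset.mul_sum]
  refine Finset.sum_congr rfl fun p _ => ?_
  ring

theorem marginalE_eq_sum (X : Matrix (a × e) (a × e) ℂ) :
    marginalE X = ∑ l, X.submatrix (fun i => (l, i)) (fun i => (l, i)) := by
  ext i j; simp [marginalE, Matrix.sum_apply]

theorem PosSemidef.marginalE {X : Matrix (a × e) (a × e) ℂ} (hX : X.PosSemidef) :
    (marginalE X).PosSemidef := by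
  rw [marginalE_eq_sum]
  exact posSemidef_sum _ fun l _ => hX.submatrix _

theorem IsHermitian.marginalE {X : Matrix (a × e) (a × e) ℂ} (hX : X.IsHermitian) :
    (marginalE X).IsHermitian := by
  ext i j
  simp only [Decoupling.marginalE, conjTranspose_apply, of_apply, star_sum]
  exact Finset.sum_congr rfl fun l _ => hX.apply _ _

theorem posSemidef_maxMixed : (maxMixed a).PosSemidef := by
  refine PosSemidef.one.smul ?_
  rw [← Complex.ofReal_natCast, ← Complex.ofReal_inv]
  exact_mod_cast (by positivity : (0 : ℝ) ≤ (Fintype.card a : ℝ)⁻¹)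

theorem unitaryChannel_eq (U : unitaryGroup a ℂ) (X : Matrix (a × e) (a × e) ℂ) :
    unitaryChannel U X = ((U : Matrix a a ℂ) ⊗ₖ (1 : Matrix e e ℂ)) * X *
      ((U : Matrix a a ℂ) ⊗ₖ (1 : Matrix e e ℂ))ᴴ := by
  rw [unitaryChannel, conjTranspose_kronecker, conjTranspose_one]

theorem trace_unitaryChannel (U : unitaryGroup a ℂ) (X : Matrix (a × e) (a × e) ℂ) :
    (unitaryChannel U X).trace = X.trace := by
  have hUU : (U : Matrix a a ℂ)ᴴ * (U : Matrix a a ℂ) = 1 := mem_unitaryGroup_iff'.mp U.2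
  rw [unitaryChannel, Matrix.trace_mul_comm, ← Matrix.mul_assoc, ← mul_kronecker_mul, hUU, one_mul,
    one_kronecker_one, one_mul]

theorem unitaryChannel_one_kronecker_mul (U : unitaryGroup a ℂ) (σ : Matrix e e ℂ)
    (X : Matrix (a × e) (a × e) ℂ) :
    unitaryChannel U (((1 : Matrix a a ℂ) ⊗ₖ σ) * X) =
      ((1 : Matrix a a ℂ) ⊗ₖ σ) * unitaryChannel U X := by
  simp only [unitaryChannel, ← Matrix.mul_assoc, ← mul_kronecker_mul, one_mul, mul_one]

theorem unitaryChannel_mul_one_kronecker (U : unitaryGroup a ℂ) (σ : Matrix e e ℂ)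
    (X : Matrix (a × e) (a × e) ℂ) :
    unitaryChannel U (X * ((1 : Matrix a a ℂ) ⊗ₖ σ)) =
      unitaryChannel U X * ((1 : Matrix a a ℂ) ⊗ₖ σ) := by
  simp only [unitaryChannel, Matrix.mul_assoc, ← mul_kronecker_mul, one_mul, mul_one]

theorem unitaryChannel_lyap (U : unitaryGroup a ℂ) (σ : Matrix e e ℂ)
    (Z : Matrix (a × e) (a × e) ℂ) :
    unitaryChannel U (lyap ((1 : Matrix a a ℂ) ⊗ₖ σ) Z) =
      lyap ((1 : Matrix a a ℂ) ⊗ₖ σ) (unitaryChannel U Z) := by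
  rw [lyap, lyap, ← unitaryChannel_one_kronecker_mul, ← unitaryChannel_mul_one_kronecker]
  simp only [unitaryChannel, Matrix.mul_smul, Matrix.smul_mul, mul_add, add_mul]

theorem unitaryChannel_sub (U : unitaryGroup a ℂ) (X Y : Matrix (a × e) (a × e) ℂ) :
    unitaryChannel U (X - Y) = unitaryChannel U X - unitaryChannel U Y := by
  simp only [unitaryChannel, mul_sub, sub_mul]

theorem unitaryChannel_maxMixed (U : unitaryGroup a ℂ) (X : Matrix e e ℂ) :
    unitaryChannel U (maxMixed a ⊗ₖ X) = maxMixed a ⊗ₖ X := by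
  have hUU : (U : Matrix a a ℂ) * (U : Matrix a a ℂ)ᴴ = 1 := mem_unitaryGroup_iff.mp U.2
  simp only [unitaryChannel, ← mul_kronecker_mul, maxMixed, Matrix.mul_smul, Matrix.smul_mul,
    mul_one, one_mul, hUU]

theorem continuous_unitaryChannel (X : Matrix (a × e) (a × e) ℂ) :
    Continuous fun U : unitaryGroup a ℂ => unitaryChannel U X := by
  have h : Continuous fun U : unitaryGroup a ℂ => (U : Matrix a a ℂ) := continuous_subtype_val
  refine continuous_matrix ?_
  rintro ⟨p, x⟩ ⟨q, y⟩
  simp only [unitaryChannel_apply]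
  exact ((h.matrix_mul continuous_const).matrix_mul h.matrix_conjTranspose).matrix_elem _ _

end SystemFacts

/-! ### The decoupling difference and its averaged Bures bound. -/

section PartialTraceFacts

variable {a₁ a₂ e : Type*} [Fintype a₁] [DecidableEq a₁] [Fintype a₂] [DecidableEq a₂]
  [Fintype e] [DecidableEq e]

theorem traceA2_eq_sum (X : Matrix ((a₁ × a₂) × e) ((a₁ × a₂) × e) ℂ) :
    traceA2 X = ∑ l, X.submatrix (fun i => ((i.1, l), i.2)) (fun i => ((i.1, l), i.2)) := by
  ext i j; simp [traceA2, Matrix.sum_apply]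

theorem PosSemidef.traceA2 {X : Matrix ((a₁ × a₂) × e) ((a₁ × a₂) × e) ℂ} (hX : X.PosSemidef) :
    (traceA2 X).PosSemidef := by
  rw [traceA2_eq_sum]
  exact posSemidef_sum _ fun l _ => hX.submatrix _

theorem IsHermitian.traceA2 {X : Matrix ((a₁ × a₂) × e) ((a₁ × a₂) × e) ℂ}
    (hX : X.IsHermitian) : (traceA2 X).IsHermitian := by
  ext i j
  simp only [Decoupling.traceA2, conjTranspose_apply, of_apply, star_sum]
  exact Finset.sum_congr rfl fun l _ => hX.apply _ _

theorem trace_traceA2 (X : Matrix ((a₁ × a₂) × e) ((a₁ × a₂) × e) ℂ) :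
    (traceA2 X).trace = X.trace := by
  simp only [trace, diag_apply, traceA2, of_apply, Fintype.sum_prod_type]
  exact Finset.sum_congr rfl fun x _ => Finset.sum_comm

theorem traceA2_sub (X Y : Matrix ((a₁ × a₂) × e) ((a₁ × a₂) × e) ℂ) :
    traceA2 (X - Y) = traceA2 X - traceA2 Y := by
  ext i j; simp [traceA2, Finset.sum_sub_distrib]

theorem traceA2_lyap (σ : Matrix e e ℂ) (Z : Matrix ((a₁ × a₂) × e) ((a₁ × a₂) × e) ℂ) :
    traceA2 (lyap ((1 : Matrix (a₁ × a₂) (a₁ × a₂) ℂ) ⊗ₖ σ) Z) =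
      lyap ((1 : Matrix a₁ a₁ ℂ) ⊗ₖ σ) (traceA2 Z) := by
  ext ⟨i, x⟩ ⟨j, y⟩
  have h1 : ∀ l : a₂, (((1 : Matrix (a₁ × a₂) (a₁ × a₂) ℂ) ⊗ₖ σ) * Z) ((i, l), x) ((j, l), y) =
      ∑ z, σ x z * Z ((i, l), z) ((j, l), y) := fun l => by
    rw [mul_apply, Fintype.sum_prod_type, Finset.sum_eq_single (i, l)]
    · simp
    · intro b _ hb
      simp [one_apply_ne hb.symm]
    · simp
  have h2 : ∀ l : a₂, (Z * ((1 : Matrix (a₁ × a₂) (a₁ × a₂) ℂ) ⊗ₖ σ)) ((i, l), x) ((j, l), y) =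
      ∑ z, Z ((i, l), x) ((j, l), z) * σ z y := fun l => by
    rw [mul_apply, Fintype.sum_prod_type, Finset.sum_eq_single (j, l)]
    · simp
    · intro b _ hb
      simp [one_apply_ne hb]
    · simp
  have h3 : (((1 : Matrix a₁ a₁ ℂ) ⊗ₖ σ) * traceA2 Z) (i, x) (j, y) =
      ∑ z, σ x z * traceA2 Z (i, z) (j, y) := by
    rw [mul_apply, Fintype.sum_prod_type, Finset.sum_eq_single i]
    · simp
    · intro b _ hb
      simp [one_apply_ne hb.symm]
    · simp
  have h4 : (traceA2 Z * ((1 : Matrix a₁ a₁ ℂ) ⊗ₖ σ)) (i, x) (j, y) =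
      ∑ z, traceA2 Z (i, x) (j, z) * σ z y := by
    rw [mul_apply, Fintype.sum_prod_type, Finset.sum_eq_single j]
    · simp
    · intro b _ hb
      simp [one_apply_ne hb]
    · simp
  simp only [lyap, Matrix.smul_apply, Matrix.add_apply, h3, h4]
  simp only [traceA2, of_apply, Matrix.smul_apply, Matrix.add_apply, h1, h2, smul_eq_mul,
    ← Finset.mul_sum, Finset.sum_add_distrib]
  rw [Finset.sum_comm, Finset.sum_comm (s := Finset.univ (α := a₂))]
  simp only [Finset.mul_sum, Finset.sum_mul]

theorem traceA2_maxMixed [Nonempty a₁] [Nonempty a₂] (X : Matrix e e ℂ) :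
    traceA2 (maxMixed (a₁ × a₂) ⊗ₖ X) = maxMixed a₁ ⊗ₖ X := by
  ext ⟨i, x⟩ ⟨j, y⟩
  have : (Fintype.card a₂ : ℂ) ≠ 0 := by exact_mod_cast Fintype.card_ne_zero
  by_cases h : i = j
  · subst h
    simp only [traceA2, maxMixed, of_apply, kronecker_apply, Matrix.smul_apply, one_apply_eq, smul_eq_mul,
      mul_one, Finset.sum_const, Finset.card_univ, nsmul_eq_mul, Fintype.card_prod]
    push_cast
    field_simp
  · simp [traceA2, maxMixed, one_apply, h]

/-- `π_A ⊗ X_E` is fixed by the unitary channel and `Tr_{A₂}` sends it to `π_{A₁} ⊗ X_E`. So only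
the part of `X` with vanishing marginal on `E` matters. -/
theorem decouplingDiff_eq_traceA2 [Nonempty a₁] [Nonempty a₂]
    (X : Matrix ((a₁ × a₂) × e) ((a₁ × a₂) × e) ℂ) (U : unitaryGroup (a₁ × a₂) ℂ) :
    decouplingDiff X U =
      traceA2 (unitaryChannel U (X - maxMixed (a₁ × a₂) ⊗ₖ marginalE X)) := by
  rw [unitaryChannel_sub, unitaryChannel_maxMixed, traceA2_sub, traceA2_maxMixed, decouplingDiff]

theorem decouplingDiff_sub (X Y : Matrix ((a₁ × a₂) × e) ((a₁ × a₂) × e) ℂ)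
    (U : unitaryGroup (a₁ × a₂) ℂ) :
    decouplingDiff (X - Y) U = decouplingDiff X U - decouplingDiff Y U := by
  simp only [decouplingDiff, unitaryChannel_sub, traceA2_sub, marginalE_sub]
  ext i j
  simp
  ring

theorem isHermitian_unitaryChannel {X : Matrix ((a₁ × a₂) × e) ((a₁ × a₂) × e) ℂ}
    (hX : X.IsHermitian) (U : unitaryGroup (a₁ × a₂) ℂ) : (unitaryChannel U X).IsHermitian := by
  rw [unitaryChannel_eq]
  exact isHermitian_mul_mul_conjTranspose _ hX

theorem isHermitian_decouplingDiff {X : Matrix ((a₁ × a₂) × e) ((a₁ × a₂) × e) ℂ}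
    (hX : X.IsHermitian) (U : unitaryGroup (a₁ × a₂) ℂ) : (decouplingDiff X U).IsHermitian := by
  refine (IsHermitian.traceA2 (isHermitian_unitaryChannel hX U)).sub ?_
  rw [IsHermitian, conjTranspose_kronecker, (IsHermitian.marginalE hX).eq,
    posSemidef_maxMixed.isHermitian.eq]

theorem marginalE_sub_maxMixed [Nonempty a₁] [Nonempty a₂]
    (X : Matrix ((a₁ × a₂) × e) ((a₁ × a₂) × e) ℂ) :
    marginalE (X - maxMixed (a₁ × a₂) ⊗ₖ marginalE X) = 0 := by
  rw [marginalE_sub, marginalE_kronecker_maxMixed, sub_self]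

theorem trace_decouplingDiff [Nonempty a₁] [Nonempty a₂]
    (X : Matrix ((a₁ × a₂) × e) ((a₁ × a₂) × e) ℂ) (U : unitaryGroup (a₁ × a₂) ℂ) :
    (decouplingDiff X U).trace = 0 := by
  rw [decouplingDiff_eq_traceA2, trace_traceA2, trace_unitaryChannel, ← trace_marginalE,
    marginalE_sub_maxMixed, trace_zero]

theorem trace_maxMixed_kronecker [Nonempty a₁] (X : Matrix e e ℂ) :
    (maxMixed a₁ ⊗ₖ X).trace = X.trace := by
  rw [← trace_marginalE, marginalE_kronecker_maxMixed]

/-- The difference of two channels increases the trace norm of a positive operator by a factor of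
at most two. -/
theorem trace_mul_decouplingDiff_le [Nonempty a₁]
    {X : Matrix ((a₁ × a₂) × e) ((a₁ × a₂) × e) ℂ} (hX : X.PosSemidef)
    (U : unitaryGroup (a₁ × a₂) ℂ) {S : Matrix (a₁ × e) (a₁ × e) ℂ} (hS : S.IsHermitian)
    (hS2 : S * S = 1) : (S * decouplingDiff X U).trace.re ≤ 2 * X.trace.re := by
  have hU : (unitaryChannel U X).PosSemidef := by
    rw [unitaryChannel_eq]; exact hX.mul_mul_conjTranspose_same _
  have h1 := trace_mul_le_of_mul_self hS hS2 (PosSemidef.traceA2 hU)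
  have h2 := trace_mul_le_of_mul_self hS hS2
    ((posSemidef_maxMixed (a := a₁)).kronecker (PosSemidef.marginalE hX))
  rw [trace_traceA2, trace_unitaryChannel] at h1
  rw [trace_maxMixed_kronecker, trace_marginalE] at h2
  rw [decouplingDiff, mul_sub, trace_sub, Complex.sub_re]
  linarith [(abs_le.mp h1).2, (abs_le.mp h2).1]

theorem trace_traceA2_mul_traceA2 (Y Z : Matrix ((a₁ × a₂) × e) ((a₁ × a₂) × e) ℂ)
    (U : unitaryGroup (a₁ × a₂) ℂ) :
    (traceA2 (unitaryChannel U Y) * traceA2 (unitaryChannel U Z)).trace =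
      ∑ x, ∑ y, ∑ i : a₁, ∑ j : a₁, ∑ k : a₂, ∑ l : a₂,
        twofoldConj (blockE Y x y ⊗ₖ blockE Z y x) U ((i, k), (j, l)) ((j, k), (i, l)) := by
  rw [trace_mul_eq_sum_blockE]
  refine Finset.sum_congr rfl fun x _ => Finset.sum_congr rfl fun y _ => ?_
  simp only [trace, diag_apply, mul_apply (M := blockE (traceA2 (unitaryChannel U Y)) x y)]
  refine Finset.sum_congr rfl fun i _ => Finset.sum_congr rfl fun j _ => ?_
  rw [blockE, blockE, of_apply, of_apply, traceA2, traceA2, of_apply, of_apply,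
    Finset.sum_mul_sum]
  refine Finset.sum_congr rfl fun k _ => Finset.sum_congr rfl fun l _ => ?_
  rw [twofoldConj_kronecker_apply, unitaryChannel_apply, unitaryChannel_apply]

/-- `Y_E = 0` says that every `E`-block of `Y` is traceless, as the moment formula requires of one
of its two arguments. -/
theorem IsUnitaryTwoDesign.integral_trace_traceA2 [Nonempty a₁] [Nonempty a₂]
    {ν : Measure (unitaryGroup (a₁ × a₂) ℂ)} (hν : IsUnitaryTwoDesign ν)
    {Y : Matrix ((a₁ × a₂) × e) ((a₁ × a₂) × e) ℂ} (hY : marginalE Y = 0)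
    (Z : Matrix ((a₁ × a₂) × e) ((a₁ × a₂) × e) ℂ) :
    ∫ U, (traceA2 (unitaryChannel U Y) * traceA2 (unitaryChannel U Z)).trace ∂ν =
      (designFactor a₁ a₂ : ℂ) * (Y * Z).trace := by
  have := hν.1
  have hint := fun (x y : e) (i j : a₁) (k l : a₂) => integrable_twofoldConj ν
    (blockE Y x y ⊗ₖ blockE Z y x) ((i, k), (j, l)) ((j, k), (i, l))
  simp only [trace_traceA2_mul_traceA2]
  rw [trace_mul_eq_sum_blockE, Finset.mul_sum]
  rw [integral_finsetSum _ fun x _ => integrable_finsetSum _ fun y _ =>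
    integrable_finsetSum _ fun i _ => integrable_finsetSum _ fun j _ =>
    integrable_finsetSum _ fun k _ => integrable_finsetSum _ fun l _ => hint x y i j k l]
  refine Finset.sum_congr rfl fun x _ => ?_
  rw [Finset.mul_sum]
  rw [integral_finsetSum _ fun y _ =>
    integrable_finsetSum _ fun i _ => integrable_finsetSum _ fun j _ =>
    integrable_finsetSum _ fun k _ => integrable_finsetSum _ fun l _ => hint x y i j k l]
  refine Finset.sum_congr rfl fun y _ => ?_
  rw [← hν.integral_partialTrace (by rw [trace_blockE, hY, Matrix.zero_apply])]
  rw [integral_finsetSum _ fun i _ => integrable_finsetSum _ fun j _ =>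
    integrable_finsetSum _ fun k _ => integrable_finsetSum _ fun l _ => hint x y i j k l]
  refine Finset.sum_congr rfl fun i _ => ?_
  rw [integral_finsetSum _ fun j _ =>
    integrable_finsetSum _ fun k _ => integrable_finsetSum _ fun l _ => hint x y i j k l]
  refine Finset.sum_congr rfl fun j _ => ?_
  rw [integral_finsetSum _ fun k _ => integrable_finsetSum _ fun l _ => hint x y i j k l]
  refine Finset.sum_congr rfl fun k _ => ?_
  rw [integral_finsetSum _ fun l _ => hint x y i j k l]

theorem continuous_traceA2_unitaryChannel (Y : Matrix ((a₁ × a₂) × e) ((a₁ × a₂) × e) ℂ) :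
    Continuous fun U : unitaryGroup (a₁ × a₂) ℂ => traceA2 (unitaryChannel U Y) :=
  continuous_matrix fun _ _ => continuous_finsetSum _ fun _ _ =>
    (continuous_unitaryChannel Y).matrix_elem _ _

theorem trace_one_kronecker_re (σ : Matrix e e ℂ) :
    ((1 : Matrix a₁ a₁ ℂ) ⊗ₖ σ).trace.re = Fintype.card a₁ * σ.trace.re := by
  rw [trace_kronecker, trace_one, ← Complex.ofReal_natCast, Complex.re_ofReal_mul]

/-- The second-moment bound behind decoupling: a pointwise bound by the Bures norm of
`Tr_{A₂}[U(Y)]` integrates to a bound by the Bures norm of `Y`. -/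
theorem IsUnitaryTwoDesign.lintegral_le_of_le_sqrt [Nonempty a₁] [Nonempty a₂]
    {ν : Measure (unitaryGroup (a₁ × a₂) ℂ)} (hν : IsUnitaryTwoDesign ν)
    {σ : Matrix e e ℂ} (hσ : σ.PosSemidef)
    {Y Z : Matrix ((a₁ × a₂) × e) ((a₁ × a₂) × e) ℂ} (hY : marginalE Y = 0)
    (hZ : Z.IsHermitian) (hYZ : lyap ((1 : Matrix (a₁ × a₂) (a₁ × a₂) ℂ) ⊗ₖ σ) Z = Y)
    {f : unitaryGroup (a₁ × a₂) ℂ → ℝ} {κ : ℝ}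
    (hf : ∀ U, ∃ S : Matrix (a₁ × e) (a₁ × e) ℂ, S.IsHermitian ∧ S * S = 1 ∧
      f U ≤ κ + 1 / 2 * (S * traceA2 (unitaryChannel U Y)).trace.re) (hκ : 0 ≤ κ) :
    ∫⁻ U, ENNReal.ofReal (f U) ∂ν ≤ ENNReal.ofReal
      (κ + 1 / 2 * Real.sqrt (Fintype.card a₁ * σ.trace.re *
        (designFactor a₁ a₂ * (Y * Z).trace.re))) := by
  have := hν.1
  set t : ℝ := Fintype.card a₁ * σ.trace.re with ht
  set g : unitaryGroup (a₁ × a₂) ℂ → ℝ := fun U =>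
    (traceA2 (unitaryChannel U Y) * traceA2 (unitaryChannel U Z)).trace.re with hg
  have hσ1 : ((1 : Matrix a₁ a₁ ℂ) ⊗ₖ σ).PosSemidef := PosSemidef.one.kronecker hσ
  have ht0 : 0 ≤ t := mul_nonneg (Nat.cast_nonneg _) (Complex.le_def.mp hσ.trace_nonneg).1
  have hlyap : ∀ U, traceA2 (unitaryChannel U Y) =
      lyap ((1 : Matrix a₁ a₁ ℂ) ⊗ₖ σ) (traceA2 (unitaryChannel U Z)) := fun U => by
    rw [← hYZ, unitaryChannel_lyap, traceA2_lyap]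
  have hZU : ∀ U, (traceA2 (unitaryChannel U Z)).IsHermitian := fun U =>
    IsHermitian.traceA2 (isHermitian_unitaryChannel hZ U)
  have hg0 : ∀ U, 0 ≤ g U := fun U => by
    rw [hg]; dsimp only
    rw [hlyap, Matrix.trace_mul_comm]
    exact trace_mul_lyap_self_nonneg hσ1 (hZU U)
  have hle : ∀ U, f U ≤ κ + 1 / 2 * Real.sqrt (t * g U) := fun U => by
    obtain ⟨S, hS, hS2, h⟩ := hf U
    have h2 := trace_mul_le_sqrt hσ1 hS hS2 (hZU U)
    rw [trace_one_kronecker_re, ← hlyap] at h2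
    linarith
  have hgc : Continuous fun U =>
      (traceA2 (unitaryChannel U Y) * traceA2 (unitaryChannel U Z)).trace :=
    ((continuous_traceA2_unitaryChannel Y).matrix_mul
      (continuous_traceA2_unitaryChannel Z)).matrix_trace
  have hgc' : Continuous g := Complex.continuous_re.comp hgc
  have hgi : ∫ U, g U ∂ν = designFactor a₁ a₂ * (Y * Z).trace.re := by
    have h1 := integral_re (integrable_of_continuous_unitaryGroup ν hgc)
    have h2 := hν.integral_trace_traceA2 hY Z
    rw [h2] at h1
    simpa [Complex.re_ofReal_mul] using h1
  have hs : Integrable (fun U => Real.sqrt (t * g U)) ν :=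
    integrable_of_continuous_unitaryGroup ν (Real.continuous_sqrt.comp (continuous_const.mul hgc'))
  have hJ : ∫ U, Real.sqrt (t * g U) ∂ν ≤ Real.sqrt (∫ U, t * g U ∂ν) :=
    Real.strictConcaveOn_sqrt.concaveOn.le_map_integral Real.continuous_sqrt.continuousOn
      isClosed_Ici (Filter.Eventually.of_forall fun U => mul_nonneg ht0 (hg0 U))
      (integrable_of_continuous_unitaryGroup ν (continuous_const.mul hgc')) hs
  rw [integral_const_mul, hgi] at hJ
  have hint : Integrable (fun U => κ + 1 / 2 * Real.sqrt (t * g U)) ν :=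
    (integrable_const κ).add (hs.const_mul _)
  calc ∫⁻ U, ENNReal.ofReal (f U) ∂ν
      ≤ ∫⁻ U, ENNReal.ofReal (κ + 1 / 2 * Real.sqrt (t * g U)) ∂ν :=
        lintegral_mono fun U => ENNReal.ofReal_le_ofReal (hle U)
    _ = ENNReal.ofReal (∫ U, κ + 1 / 2 * Real.sqrt (t * g U) ∂ν) :=
        (ofReal_integral_eq_lintegral_ofReal hint
          (Filter.Eventually.of_forall fun U => by positivity)).symm
    _ ≤ _ := by
        refine ENNReal.ofReal_le_ofReal ?_
        rw [integral_add (integrable_const κ) (hs.const_mul _), integral_const_mul]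
        simp only [integral_const, probReal_univ, one_smul]
        linarith

/-- Removing the component `π_A ⊗ R_E` does not increase the Bures norm. -/
theorem trace_mul_sub_maxMixed_le [Nonempty a₁] [Nonempty a₂] {σ : Matrix e e ℂ}
    (hσ : σ.PosSemidef) {R Z : Matrix ((a₁ × a₂) × e) ((a₁ × a₂) × e) ℂ} (hZ : Z.IsHermitian)
    (hR : lyap ((1 : Matrix (a₁ × a₂) (a₁ × a₂) ℂ) ⊗ₖ σ) Z = R) :
    lyap ((1 : Matrix (a₁ × a₂) (a₁ × a₂) ℂ) ⊗ₖ σ)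
        (Z - maxMixed (a₁ × a₂) ⊗ₖ marginalE Z) = R - maxMixed (a₁ × a₂) ⊗ₖ marginalE R ∧
      ((R - maxMixed (a₁ × a₂) ⊗ₖ marginalE R) *
        (Z - maxMixed (a₁ × a₂) ⊗ₖ marginalE Z)).trace.re ≤ (R * Z).trace.re := by
  have hRE : marginalE R = lyap σ (marginalE Z) := by rw [← hR, marginalE_lyap]
  constructor
  · rw [← lyapLin_apply, map_sub, lyapLin_apply, lyapLin_apply, hR, lyap_one_kronecker, hRE]
  -- The form drops by exactly `|A|⁻¹ Tr R_E Z_E = |A|⁻¹ Tr Z_E J_σ(Z_E) ≥ 0`.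
  · have h0 := trace_mul_lyap_self_nonneg hσ (IsHermitian.marginalE hZ)
    rw [← hRE, Matrix.trace_mul_comm] at h0
    rw [mul_sub, trace_sub, trace_mul_maxMixed_kronecker, marginalE_sub_maxMixed, zero_mul,
      trace_zero, mul_zero, sub_zero, sub_mul, trace_sub, Complex.sub_re,
      Matrix.trace_mul_comm (maxMixed (a₁ × a₂) ⊗ₖ marginalE R), trace_mul_maxMixed_kronecker,
      Matrix.trace_mul_comm (marginalE Z), ← Complex.ofReal_natCast, ← Complex.ofReal_inv,
      Complex.re_ofReal_mul]
    have : 0 ≤ ((Fintype.card (a₁ × a₂) : ℝ))⁻¹ * (marginalE R * marginalE Z).trace.re := by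
      positivity
    linarith

end PartialTraceFacts

/-! ### Classical smoothing: dual bound and comparison of `D₂` with `D_max`. -/

section ClassicalFacts

variable {k : ℕ}

/-- The left side is the mass of the positive part of `p - p'`; the plus norm controls it with
constant one. -/
theorem sum_sub_min_le_classicalPlusNorm (p p' : Fin k → ℝ) :
    ∑ i, (p i - min (p i) (p' i)) ≤ classicalPlusNorm (fun i => p i - p' i) := by
  have h : ∀ i, p i - min (p i) (p' i) = 1 / 2 * (p i - p' i) + 1 / 2 * |p i - p' i| := fun i => by
    rcases le_total (p i) (p' i) with hi | hi
    · rw [min_eq_left hi, abs_of_nonpos (by linarith)]; ring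
    · rw [min_eq_right hi, abs_of_nonneg (by linarith)]; ring
  simp only [h, Finset.sum_add_distrib, ← Finset.mul_sum, classicalPlusNorm]
  linarith [le_abs_self (∑ i, (p i - p' i))]

/-- For `q > 0` this is `(x - qh)² ≥ 0` followed by `x ≤ y`. For `q = 0` either `x = y = 0` or the
right side is infinite. -/
theorem ofReal_linearization_le_div {x y q h : ℝ} (hx : 0 ≤ x) (hxy : x ≤ y) (hq : 0 ≤ q) :
    ENNReal.ofReal (2 * x * h - q * h ^ 2) ≤ ENNReal.ofReal (y ^ 2) / ENNReal.ofReal q := by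
  rcases hq.eq_or_lt with rfl | hq
  · rcases (hx.trans hxy).eq_or_lt with hy | hy
    · have : x = 0 := le_antisymm (hy ▸ hxy) hx
      simp [this]
    · rw [ENNReal.ofReal_zero, ENNReal.div_zero]
      · exact le_top
      · rw [Ne, ENNReal.ofReal_eq_zero, not_le]; positivity
  · rw [← ENNReal.ofReal_div_of_pos hq]
    refine ENNReal.ofReal_le_ofReal ?_
    rw [le_div_iff₀ hq]
    nlinarith [sq_nonneg (x - q * h)]

/-- Linearised at `min(p, p')` instead of `p'`, so that the deficit from `p` is nonnegative with
mass at most `ε` and `τ` bounds its pairing with `h`, whatever the signs of `h`. -/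
theorem le_classicalD2_of_mem_smoothingBall {ε τ : ℝ} {p q p' h : Fin k → ℝ} (hp : ∀ i, 0 ≤ p i)
    (hq : ∀ i, 0 ≤ q i) (hp' : p' ∈ smoothingBall ε p)
    (hτ : ∀ x : Fin k → ℝ, (∀ i, 0 ≤ x i) → ∑ i, x i ≤ ε → ∑ i, x i * h i ≤ τ) :
    ENNReal.log (ENNReal.ofReal (2 * ∑ i, p i * h i - 2 * τ - ∑ i, q i * h i ^ 2)) ≤
      classicalD2 p' q := by
  refine ENNReal.log_monotone ?_
  obtain ⟨hp'0, -, hball⟩ := hp'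
  have h1 := hτ (fun i => p i - min (p i) (p' i)) (fun i => sub_nonneg.mpr (min_le_left _ _))
    ((sum_sub_min_le_classicalPlusNorm p p').trans hball)
  have h2 : 2 * ∑ i, p i * h i - 2 * τ - ∑ i, q i * h i ^ 2 ≤
      ∑ i, (2 * min (p i) (p' i) * h i - q i * h i ^ 2) := by
    simp only [sub_mul, Finset.sum_sub_distrib, mul_assoc, ← Finset.mul_sum] at h1 ⊢
    linarith
  have h3 : ∀ (s : Finset (Fin k)) (f : Fin k → ℝ),
      ENNReal.ofReal (∑ i ∈ s, f i) ≤ ∑ i ∈ s, ENNReal.ofReal (f i) := by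
    intro s f
    induction s using Finset.cons_induction with
    | empty => simp
    | cons a s ha ih =>
      rw [Finset.sum_cons, Finset.sum_cons]
      exact ENNReal.ofReal_add_le.trans (by gcongr)
  calc _ ≤ ENNReal.ofReal (∑ i, (2 * min (p i) (p' i) * h i - q i * h i ^ 2)) :=
        ENNReal.ofReal_le_ofReal h2
    _ ≤ ∑ i, ENNReal.ofReal (2 * min (p i) (p' i) * h i - q i * h i ^ 2) := h3 _ _
    _ ≤ _ := Finset.sum_le_sum fun i _ =>
        ofReal_linearization_le_div (le_min (hp i) (hp'0 i)) (min_le_right _ _) (hq i)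

theorem exp_smoothD2_le {ε : ℝ} (hε0 : 0 ≤ ε) (hε : ε < 1) {p q : Fin k → ℝ} (hp : ∀ i, 0 ≤ p i)
    (hp1 : ∑ i, p i = 1) :
    EReal.exp (smoothD2 ε p q) ≤ ENNReal.ofReal (1 - ε) * EReal.exp (smoothDmax ε p q) := by
  have hε1 : 0 < 1 - ε := by linarith
  have hne : ENNReal.ofReal (1 - ε) ≠ 0 := by simpa using hε
  rw [mul_comm, ← ENNReal.div_le_iff_le_mul (Or.inl hne) (Or.inl ENNReal.ofReal_ne_top)]
  rw [← ENNReal.exp_log (EReal.exp (smoothD2 ε p q) / _)]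
  refine EReal.exp_monotone (le_iInf₂ fun p' hp' => ENNReal.log_monotone ?_)
  refine le_iInf₂ fun t ht => ?_
  rw [ENNReal.div_le_iff_le_mul (Or.inl hne) (Or.inl ENNReal.ofReal_ne_top)]
  obtain ⟨hp'0, -, hball⟩ := hp'
  set m : Fin k → ℝ := fun i => min (p i) (p' i) with hm
  have hm0 : ∀ i, 0 ≤ m i := fun i => le_min (hp i) (hp'0 i)
  have hs : 1 - ε ≤ ∑ i, m i := by
    have := (sum_sub_min_le_classicalPlusNorm p p').trans hball
    rw [Finset.sum_sub_distrib, hp1] at this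
    linarith
  have hs0 : 0 < ∑ i, m i := hε1.trans_le hs
  -- Rescaling `min(p, p')` to mass exactly `1 - ε` stays below `p`, at plus distance exactly `ε`.
  -- It also stays below `p' ≤ tq`, whence `∑ x²/q ≤ t ∑ x = t(1 - ε)`.
  set c : ℝ := (1 - ε) / ∑ i, m i with hc
  have hc0 : 0 ≤ c := by positivity
  have hc1 : c ≤ 1 := (div_le_one hs0).mpr hs
  have hsum : ∑ i, c * m i = 1 - ε := by
    rw [← Finset.mul_sum, hc, div_mul_cancel₀ _ hs0.ne']
  have hcm : ∀ i, c * m i ≤ m i := fun i => mul_le_of_le_one_left (hm0 i) hc1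
  have hmem : (fun i => c * m i) ∈ smoothingBall ε p := by
    refine ⟨fun i => mul_nonneg hc0 (hm0 i), by rw [hsum]; linarith, ?_⟩
    have habs : ∀ i, |p i - c * m i| = p i - c * m i := fun i =>
      abs_of_nonneg (sub_nonneg.mpr ((hcm i).trans (min_le_left _ _)))
    simp only [classicalPlusNorm, habs]
    rw [Finset.sum_sub_distrib, hp1, hsum, abs_of_nonneg (by linarith)]
    linarith
  calc EReal.exp (smoothD2 ε p q) ≤ EReal.exp (classicalD2 (fun i => c * m i) q) :=
        EReal.exp_monotone (iInf₂_le _ hmem)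
    _ = ∑ i, ENNReal.ofReal ((c * m i) ^ 2) / ENNReal.ofReal (q i) := ENNReal.exp_log _
    _ ≤ ∑ i, (t : ℝ≥0∞) * ENNReal.ofReal (c * m i) := by
        refine Finset.sum_le_sum fun i _ => ENNReal.div_le_of_le_mul ?_
        rw [← ENNReal.ofReal_coe_nnreal, ← ENNReal.ofReal_mul t.coe_nonneg,
          ← ENNReal.ofReal_mul (mul_nonneg t.coe_nonneg (mul_nonneg hc0 (hm0 i)))]
        refine ENNReal.ofReal_le_ofReal ?_
        have h1 : c * m i ≤ t * q i := (hcm i).trans ((min_le_right _ _).trans (ht i))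
        have h2 : 0 ≤ c * m i := mul_nonneg hc0 (hm0 i)
        nlinarith [mul_le_mul_of_nonneg_left h1 h2]
    _ = (t : ℝ≥0∞) * ENNReal.ofReal (1 - ε) := by
        rw [← Finset.mul_sum, ← ENNReal.ofReal_sum_of_nonneg fun i _ => mul_nonneg hc0 (hm0 i),
          hsum]

end ClassicalFacts

/-! ### Optimal quantum smoothing and the measured divergence. -/

section MeasuredFacts

variable {n : Type*} [Fintype n] [DecidableEq n]

theorem Measurement.outcome_nonneg {k : ℕ} (M : Measurement n k) {X : Matrix n n ℂ}
    (hX : X.PosSemidef) (i : Fin k) : 0 ≤ M.outcome X i :=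
  trace_mul_nonneg_of_posSemidef (M.posSemidef i) hX

theorem Measurement.sum_outcome {k : ℕ} (M : Measurement n k) (X : Matrix n n ℂ) :
    ∑ i, M.outcome X i = X.trace.re := by
  simp only [Measurement.outcome]
  rw [← Complex.re_sum, ← trace_sum, ← Finset.sum_mul, M.sum_eq_one, one_mul]

theorem measuredQ2_le_measuredQmax {ε : ℝ} (hε0 : 0 ≤ ε) (hε : ε < 1) {ρ : Matrix n n ℂ}
    (hρ : IsState ρ) (σ : Matrix n n ℂ) :
    measuredQ2 ε ρ σ ≤ ENNReal.ofReal (1 - ε) * measuredQmax ε ρ σ := by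
  rw [← ENNReal.exp_log (ENNReal.ofReal (1 - ε) * measuredQmax ε ρ σ)]
  refine EReal.exp_monotone (iSup₂_le fun k M => ?_)
  rw [← EReal.log_exp (smoothD2 _ _ _)]
  refine ENNReal.log_monotone ((exp_smoothD2_le hε0 hε (M.outcome_nonneg hρ.1) ?_).trans ?_)
  · rw [M.sum_outcome, hρ.2, Complex.one_re]
  · refine mul_le_mul_right (EReal.exp_monotone ?_) _
    exact le_iSup₂ (f := fun k (M : Measurement n k) =>
      smoothDmax ε (M.outcome ρ) (M.outcome σ)) k M

/-- The set is the image under `B ↦ B†B` of a Hilbert–Schmidt ball, whose entries are bounded by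
`√ε`. -/
theorem isCompact_posSemidef_trace_le (ε : ℝ) :
    IsCompact {X : Matrix n n ℂ | X.PosSemidef ∧ X.trace.re ≤ ε} := by
  have hc : Continuous fun B : Matrix n n ℂ => Bᴴ * B :=
    continuous_id.matrix_conjTranspose.matrix_mul continuous_id
  have hK : IsCompact {B : Matrix n n ℂ | (Bᴴ * B).trace.re ≤ ε} := by
    have hsub : {B : Matrix n n ℂ | (Bᴴ * B).trace.re ≤ ε} ⊆
        Set.univ.pi fun _ => Set.univ.pi fun _ => Metric.closedBall (0 : ℂ) (Real.sqrt ε) := by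
      intro B hB i _ j _
      rw [mem_closedBall_zero_iff]
      refine Real.le_sqrt_of_sq_le (le_trans ?_ hB)
      simp only [trace, diag_apply, mul_apply, conjTranspose_apply, Complex.re_sum]
      have h : ∀ x y, (star (B y x) * B y x).re = ‖B y x‖ ^ 2 := fun x y => by
        rw [Complex.star_def, ← Complex.normSq_eq_conj_mul_self, Complex.ofReal_re,
          Complex.normSq_eq_norm_sq]
      simp only [h]
      calc ‖B i j‖ ^ 2 ≤ ∑ y, ‖B y j‖ ^ 2 :=
            Finset.single_le_sum (f := fun y => ‖B y j‖ ^ 2) (fun _ _ => by positivity)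
              (Finset.mem_univ i)
        _ ≤ _ := Finset.single_le_sum (f := fun x => ∑ y, ‖B y x‖ ^ 2)
            (fun _ _ => Finset.sum_nonneg fun _ _ => by positivity) (Finset.mem_univ j)
    exact (isCompact_univ_pi fun _ => isCompact_univ_pi fun _ =>
      isCompact_closedBall (0 : ℂ) _).of_isClosed_subset
        (isClosed_le (Complex.continuous_re.comp hc.matrix_trace) continuous_const) hsub
  convert hK.image hc using 1
  ext X
  constructor
  · rintro ⟨hX, hX'⟩
    obtain ⟨B, rfl⟩ := CStarAlgebra.nonneg_iff_eq_star_mul_self.mp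
      (Matrix.nonneg_iff_posSemidef.mpr hX)
    exact ⟨B, hX', rfl⟩
  · rintro ⟨B, hB, rfl⟩
    exact ⟨posSemidef_conjTranspose_mul_self B, hB⟩

/-- First-order optimality for the Bures distance of `ρ` to the set of positive operators of trace
at most `ε`. -/
theorem exists_optimal_smoothing {ρ s : Matrix n n ℂ} (hρ : ρ.IsHermitian) (hs : s.PosDef)
    {ε : ℝ} (hε : 0 ≤ ε) :
    ∃ X Z : Matrix n n ℂ, X.PosSemidef ∧ X.trace.re ≤ ε ∧ Z.IsHermitian ∧ lyap s Z = ρ - X ∧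
      ∀ X' : Matrix n n ℂ, X'.PosSemidef → X'.trace.re ≤ ε →
        (X' * Z).trace.re ≤ (X * Z).trace.re := by
  let J := LinearEquiv.ofInjectiveEndo (lyapLin s) (lyap_injective hs)
  have hJ : ∀ A, lyap s (J.symm A) = A := fun A => J.apply_symm_apply A
  have hGc : Continuous J.symm := LinearMap.continuous_of_finiteDimensional J.symm.toLinearMap
  have hfc : Continuous fun X : Matrix n n ℂ => ((ρ - X) * J.symm (ρ - X)).trace.re :=
    Complex.continuous_re.comp (((continuous_const.sub continuous_id).matrix_mul
      (hGc.comp (continuous_const.sub continuous_id))).matrix_trace)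
  obtain ⟨X, ⟨hX, hXε⟩, hmin⟩ := (isCompact_posSemidef_trace_le (n := n) ε).exists_isMinOn
    ⟨0, PosSemidef.zero, by simpa using hε⟩ hfc.continuousOn
  refine ⟨X, J.symm (ρ - X), hX, hXε, ?_, hJ _, fun X' hX' hX'ε => ?_⟩
  · refine lyap_injective hs ?_
    rw [lyapLin_apply, lyapLin_apply, ← conjTranspose_lyap hs.isHermitian, hJ,
      (hρ.sub hX.isHermitian).eq]
  set Z := J.symm (ρ - X) with hZ
  set D := X' - X with hD
  have hexp : ∀ (W : Matrix n n ℂ) (t : ℝ),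
      ((W - (t : ℂ) • D) * J.symm (W - (t : ℂ) • D)).trace.re = (W * J.symm W).trace.re -
        2 * t * (D * J.symm W).trace.re + t ^ 2 * (D * J.symm D).trace.re := by
    intro W t
    have hsymm : (W * J.symm D).trace = (D * J.symm W).trace := by
      conv_lhs => rw [← hJ W, trace_lyap_mul, hJ, Matrix.trace_mul_comm]
    rw [map_sub, map_smul]
    simp only [mul_sub, sub_mul, Matrix.smul_mul, Matrix.mul_smul, trace_sub, trace_smul, hsymm,
      smul_eq_mul, Complex.sub_re, Complex.re_ofReal_mul]
    ring
  -- Minimality of `X` along the feasible segment towards `X'`.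
  have key : ∀ t : ℝ, 0 < t → t ≤ 1 →
      0 ≤ -2 * t * (D * Z).trace.re + t ^ 2 * (D * J.symm D).trace.re := by
    intro t ht ht1
    have hmem : X + (t : ℂ) • D ∈ {X : Matrix n n ℂ | X.PosSemidef ∧ X.trace.re ≤ ε} := by
      have e : X + (t : ℂ) • D = (1 - t) • X + t • X' := by
        rw [Complex.coe_smul, hD]; module
      rw [e]
      refine ⟨(hX.smul (by linarith)).add (hX'.smul ht.le), ?_⟩
      rw [trace_add, trace_smul, trace_smul, Complex.add_re, Complex.smul_re, Complex.smul_re,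
        smul_eq_mul, smul_eq_mul]
      nlinarith
    have h := hmin hmem
    have e : ρ - (X + (t : ℂ) • D) = (ρ - X) - (t : ℂ) • D := by abel
    change ((ρ - X) * J.symm (ρ - X)).trace.re ≤
      ((ρ - (X + (t : ℂ) • D)) * J.symm (ρ - (X + (t : ℂ) • D))).trace.re at h
    rw [e, hexp, ← hZ] at h
    linarith
  have hDZ : (D * Z).trace.re ≤ 0 := by
    by_contra! hb
    set b := (D * Z).trace.re
    set r := (D * J.symm D).trace.re
    have hr : 0 < |r| + 1 := by positivity
    -- A step this short has `t |r| < b`, so the negative linear term beats the quadratic one.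
    have ht : 0 < min 1 (b / (|r| + 1)) := lt_min one_pos (div_pos hb hr)
    have h1 := key _ ht (min_le_left _ _)
    have h2 : min 1 (b / (|r| + 1)) * (|r| + 1) ≤ b := by
      rw [← le_div_iff₀ hr]; exact min_le_right _ _
    set t := min 1 (b / (|r| + 1))
    have h3 : t * r ≤ t * |r| := mul_le_mul_of_nonneg_left (le_abs_self r) ht.le
    have h4 : 0 < t * (2 * b - t * r) := mul_pos ht (by linarith)
    linarith [h4, h1, show t * (2 * b - t * r) = -(-2 * t * b + t ^ 2 * r) by ring]
  rw [hD, sub_mul, trace_sub, Complex.sub_re] at hDZ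
  linarith

/-- The measured divergence dominates the Bures distance to the smoothing set: the spectral
measurement of the optimal dual operator is a witness. -/
theorem exists_smoothing_le_measuredQ2 {ρ σ s : Matrix n n ℂ} (hρ : ρ.PosSemidef)
    (hσ : σ.PosSemidef) (hs : s.PosDef) (hσs : (s - σ).PosSemidef) {ε : ℝ} (hε : 0 ≤ ε) :
    ∃ X Z : Matrix n n ℂ, X.PosSemidef ∧ X.trace.re ≤ ε ∧ Z.IsHermitian ∧ lyap s Z = ρ - X ∧
      ENNReal.ofReal ((ρ - X) * Z).trace.re ≤ measuredQ2 ε ρ σ := by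
  obtain ⟨X, Z, hX, hXε, hZ, hZX, hopt⟩ := exists_optimal_smoothing hρ.isHermitian hs hε
  refine ⟨X, Z, hX, hXε, hZ, hZX, ?_⟩
  obtain ⟨U, h, hU, hU', hZU⟩ := exists_unitary_diagonalization hZ
  let D : (n → ℝ) → Matrix n n ℂ := fun x => U * diagonal (fun i => (x i : ℂ)) * Uᴴ
  have hDpos : ∀ x : n → ℝ, (∀ i, 0 ≤ x i) → (D x).PosSemidef := fun x hx => by
    refine PosSemidef.mul_mul_conjTranspose_same ?_ U
    rw [posSemidef_diagonal_iff]
    exact fun i => by exact_mod_cast hx i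
  have hDmul : ∀ x y : n → ℝ, D x * D y = D fun i => x i * y i := fun x y => by
    simp only [D, conj_diagonal_mul_conj_diagonal hU, Complex.ofReal_mul]
  have hDtr : ∀ x : n → ℝ, (D x).trace.re = ∑ i, x i := fun x => by
    simp only [D]
    rw [Matrix.trace_mul_comm, ← Matrix.mul_assoc, hU, one_mul, trace_diagonal, Complex.re_sum]
    simp
  have hD1 : D (fun _ => 1) = 1 := by
    simp only [D, Complex.ofReal_one, diagonal_one, mul_one, hU']
  have hDsum : ∀ x : n → ℝ, ∑ i, (x i : ℂ) • D (Pi.single i 1) = D x := fun x => by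
    simp only [D, ← Matrix.smul_mul, ← Finset.sum_mul]
    congr 1
    ext i j
    simp [Matrix.sum_apply, Pi.single_apply, apply_ite Complex.ofReal, mul_comm]
  let φ := Fintype.equivFin n
  let M : Measurement n (Fintype.card n) :=
    { elem := fun i => D (Pi.single (φ.symm i) 1)
      posSemidef := fun i => hDpos _ fun j => by
        by_cases hj : j = φ.symm i <;> simp [hj]
      sum_eq_one := by
        rw [φ.symm.sum_comp fun i => D (Pi.single i 1), ← hD1, ← hDsum fun _ => 1]
        simp }
  have hout : ∀ (A : Matrix n n ℂ) (x : n → ℝ),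
      ∑ i, M.outcome A i * x (φ.symm i) = (A * D x).trace.re := fun A x => by
    change ∑ i, (D (Pi.single (φ.symm i) 1) * A).trace.re * x (φ.symm i) = _
    rw [φ.symm.sum_comp fun i => (D (Pi.single i 1) * A).trace.re * x i, ← hDsum x,
      Finset.mul_sum, trace_sum, Complex.re_sum]
    refine Finset.sum_congr rfl fun i _ => ?_
    rw [Matrix.mul_smul, trace_smul, smul_eq_mul, Complex.re_ofReal_mul, mul_comm,
      Matrix.trace_mul_comm]
  have hZD : Z = D h := hZU
  have hZZ : Z * Z = D fun i => h i ^ 2 := by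
    rw [hZD, hDmul]; simp only [sq]
  -- A classical deficit `x`, placed on the eigenbasis of `Z`, is a feasible competitor of `X`;
  -- optimality thus gives `τ = Tr XZ`.
  have hτ : ∀ x : Fin (Fintype.card n) → ℝ, (∀ i, 0 ≤ x i) → ∑ i, x i ≤ ε →
      ∑ i, x i * h (φ.symm i) ≤ (X * Z).trace.re := by
    intro x hx hxε
    have h1 := hopt (D fun i => x (φ i)) (hDpos _ fun i => hx _) (by
      rw [hDtr, φ.sum_comp x]; exact hxε)
    rw [hZD, hDmul, hDtr] at h1
    rw [← φ.sum_comp fun i => x i * h (φ.symm i), hZD]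
    simpa using h1
  rw [← ENNReal.exp_log (ENNReal.ofReal _)]
  refine EReal.exp_monotone (le_trans ?_ (le_iSup₂ (f := fun k (M : Measurement n k) =>
      smoothD2 ε (M.outcome ρ) (M.outcome σ)) _ M))
  refine le_iInf₂ fun p' hp' => le_trans (ENNReal.log_monotone (ENNReal.ofReal_le_ofReal ?_))
    (le_classicalD2_of_mem_smoothingBall (M.outcome_nonneg hρ) (M.outcome_nonneg hσ) hp' hτ)
  rw [hout ρ h, hout σ fun i => h i ^ 2, ← hZD, ← hZZ]
  -- With `v = Tr(ρ - X)Z = Tr sZ²`, the dual value is `2v - Tr σZ² ≥ 2v - Tr sZ² = v`.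
  have h1 : ((ρ - X) * Z).trace = (s * (Z * Z)).trace := by
    rw [← hZX, Matrix.trace_mul_comm, trace_mul_lyap_self]
  have h2 := trace_mul_nonneg_of_posSemidef hσs
    (show (Z * Z).PosSemidef by simpa only [hZ.eq] using posSemidef_conjTranspose_mul_self Z)
  have h3 := congrArg Complex.re h1
  rw [sub_mul, trace_sub, Complex.sub_re] at h2 h3 ⊢
  linarith

end MeasuredFacts

/-! ### Constants, degenerate cases and the two decoupling bounds. -/

section MainBounds

variable {a₁ a₂ e : Type*} [Fintype a₁] [DecidableEq a₁] [Nonempty a₁]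
  [Fintype a₂] [DecidableEq a₂] [Nonempty a₂] [Fintype e] [DecidableEq e]

theorem traceNorm_zero {n : Type*} [Fintype n] [DecidableEq n] :
    traceNorm (0 : Matrix n n ℂ) = 0 := by
  simp [traceNorm]

theorem plusNorm_decouplingDiff (X : Matrix ((a₁ × a₂) × e) ((a₁ × a₂) × e) ℂ)
    (U : unitaryGroup (a₁ × a₂) ℂ) :
    plusNorm (decouplingDiff X U) = 1 / 2 * traceNorm (decouplingDiff X U) := by
  rw [plusNorm, trace_decouplingDiff, norm_zero, mul_zero, zero_add]

theorem marginalE_unitaryChannel {a : Type*} [Fintype a] [DecidableEq a]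
    (U : unitaryGroup a ℂ) (X : Matrix (a × e) (a × e) ℂ) :
    marginalE (unitaryChannel U X) = marginalE X := by
  ext x y
  rw [← trace_blockE X, ← trace_unitary_conj _ U]
  simp only [marginalE, of_apply, unitaryChannel_apply]
  rfl

theorem traceA2_of_subsingleton [Subsingleton a₁]
    (X : Matrix ((a₁ × a₂) × e) ((a₁ × a₂) × e) ℂ) (i j : a₁ × e) :
    traceA2 X i j = marginalE X i.2 j.2 := by
  obtain ⟨i, x⟩ := i
  obtain ⟨j, y⟩ := j
  obtain rfl := Subsingleton.elim i j
  simp only [traceA2, marginalE, of_apply, Fintype.sum_prod_type]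
  rw [Fintype.sum_subsingleton _ i]

/-- For `|A₁| = 1` the map `Tr_{A₂}` is `Tr_A`, which sees only `Y_E = 0`. This covers the case of a
zero constant times an infinite Bures norm. -/
theorem decouplingDiff_of_subsingleton [Subsingleton a₁]
    (X : Matrix ((a₁ × a₂) × e) ((a₁ × a₂) × e) ℂ) (U : unitaryGroup (a₁ × a₂) ℂ) :
    decouplingDiff X U = 0 := by
  rw [decouplingDiff_eq_traceA2]
  ext i j
  rw [traceA2_of_subsingleton, marginalE_unitaryChannel, marginalE_sub_maxMixed]
  rfl

theorem card_mul_designFactor : (Fintype.card a₁ : ℝ) * designFactor a₁ a₂ =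
    (Fintype.card (a₁ × a₂) : ℝ) * ((Fintype.card a₁ : ℝ) ^ 2 - 1) /
      ((Fintype.card (a₁ × a₂) : ℝ) ^ 2 - 1) := by
  rw [designFactor, ← mul_div_assoc, Fintype.card_prod]
  push_cast
  ring

/-- After clearing denominators this is `|A|² - |A₂|² ≤ |A|² - 1`; at `|A| = 1` the factor reads as
`0`. -/
theorem designFactor_le : designFactor a₁ a₂ ≤ (Fintype.card a₂ : ℝ)⁻¹ := by
  have h1 : (1 : ℝ) ≤ Fintype.card a₁ := by exact_mod_cast Fintype.card_pos (α := a₁)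
  have h2 : (1 : ℝ) ≤ Fintype.card a₂ := by exact_mod_cast Fintype.card_pos (α := a₂)
  rw [designFactor, Fintype.card_prod]
  push_cast
  rcases eq_or_ne (((Fintype.card a₁ : ℝ) * Fintype.card a₂) ^ 2 - 1) 0 with h | h
  · rw [h, div_zero]; positivity
  · have h3 : 1 ≤ (Fintype.card a₁ : ℝ) * Fintype.card a₂ := by nlinarith
    have h4 : 0 < ((Fintype.card a₁ : ℝ) * Fintype.card a₂) ^ 2 - 1 :=
      lt_of_le_of_ne (by nlinarith) h.symm
    rw [div_le_iff₀ h4, inv_mul_eq_div, le_div_iff₀ (by linarith)]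
    nlinarith

theorem card_mul_designFactor_pos (h : 1 < Fintype.card a₁) :
    0 < (Fintype.card a₁ : ℝ) * designFactor a₁ a₂ := by
  have h1 : (1 : ℝ) < Fintype.card a₁ := by exact_mod_cast h
  have h2 : (1 : ℝ) ≤ Fintype.card a₂ := by exact_mod_cast Fintype.card_pos (α := a₂)
  rw [designFactor, Fintype.card_prod]
  push_cast
  have h3 : 1 < (Fintype.card a₁ : ℝ) * Fintype.card a₂ := by nlinarith
  have h4 : 0 < ((Fintype.card a₁ : ℝ) * Fintype.card a₂) ^ 2 - 1 := by nlinarith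
  have h5 : 0 < (Fintype.card a₁ : ℝ) ^ 2 - 1 := by nlinarith
  positivity

theorem IsUnitaryTwoDesign.lintegral_plusNorm_le {ν : Measure (unitaryGroup (a₁ × a₂) ℂ)}
    (hν : IsUnitaryTwoDesign ν) {σ : Matrix e e ℂ} (hσ : IsState σ)
    {R : Matrix ((a₁ × a₂) × e) ((a₁ × a₂) × e) ℂ} (hR : R.IsHermitian) :
    ∫⁻ U, ENNReal.ofReal (plusNorm (decouplingDiff R U)) ∂ν ≤
      ENNReal.ofReal (1 / 2 * Real.sqrt (Fintype.card a₁ * designFactor a₁ a₂)) *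
        buresNorm ((1 : Matrix (a₁ × a₂) (a₁ × a₂) ℂ) ⊗ₖ σ)
          (R - maxMixed (a₁ × a₂) ⊗ₖ marginalE R) := by
  have hs : ((1 : Matrix (a₁ × a₂) (a₁ × a₂) ℂ) ⊗ₖ σ).PosSemidef :=
    PosSemidef.one.kronecker hσ.1
  rw [buresNorm]
  split_ifs with hY
  · obtain ⟨hZ, hYZ⟩ := lyapInv_spec hs.isHermitian hY
    refine (hν.lintegral_le_of_le_sqrt hσ.1 (marginalE_sub_maxMixed R) hZ hYZ (κ := 0)
      (fun U => ?_) le_rfl).trans ?_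
    · obtain ⟨S, hS, hS2, h⟩ := exists_traceNorm_eq (isHermitian_decouplingDiff hR U)
      refine ⟨S, hS, hS2, ?_⟩
      rw [plusNorm_decouplingDiff, h, decouplingDiff_eq_traceA2, zero_add]
    · have hc : 0 ≤ (Fintype.card a₁ : ℝ) * designFactor a₁ a₂ := by
        rcases (Nat.one_le_iff_ne_zero.mpr (Fintype.card_ne_zero (α := a₁))).eq_or_lt with h | h
        · simp [designFactor, ← h]
        · exact (card_mul_designFactor_pos h).le
      rw [← ENNReal.ofReal_mul (by positivity), hσ.2, Complex.one_re, mul_one, zero_add,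
        ← mul_assoc, Real.sqrt_mul hc, mul_assoc]
  -- Infinite Bures norm: the bound is trivial unless the constant vanishes, and then the left side
  -- is zero.
  · rcases (Nat.one_le_iff_ne_zero.mpr (Fintype.card_ne_zero (α := a₁))).eq_or_lt with h | h
    · have : Subsingleton a₁ := Fintype.card_le_one_iff_subsingleton.mp h.ge
      have h0 : ∀ U, plusNorm (decouplingDiff R U) = 0 := fun U => by
        rw [plusNorm_decouplingDiff, decouplingDiff_of_subsingleton, traceNorm_zero, mul_zero]
      simp [h0]
    · have := card_mul_designFactor_pos (a₂ := a₂) h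
      rw [ENNReal.mul_top]
      · exact le_top
      · rw [Ne, ENNReal.ofReal_eq_zero, not_le]
        positivity

/-- Replacing `σ` by `σ + δ1` makes `J` invertible, so the nearest smoothing exists. The price is
only the trace `1 + δ|E|`, since `measuredQ2` is still taken at `σ`. -/
theorem IsUnitaryTwoDesign.lintegral_traceNorm_le_of_pos {ν : Measure (unitaryGroup (a₁ × a₂) ℂ)}
    (hν : IsUnitaryTwoDesign ν) {σ : Matrix e e ℂ} (hσ : IsState σ)
    {ρ : Matrix ((a₁ × a₂) × e) ((a₁ × a₂) × e) ℂ} (hρ : ρ.PosSemidef) {ε δ : ℝ} (hε : 0 ≤ ε)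
    (hδ : 0 < δ) :
    ∫⁻ U, ENNReal.ofReal (1 / 2 * traceNorm (decouplingDiff ρ U)) ∂ν ≤
      ENNReal.ofReal ε + 1 / 2 *
        (ENNReal.ofReal ((Fintype.card a₁ : ℝ) / (Fintype.card a₂ : ℝ)) *
          (ENNReal.ofReal (1 + δ * Fintype.card e) *
            measuredQ2 ε ρ ((1 : Matrix (a₁ × a₂) (a₁ × a₂) ℂ) ⊗ₖ σ))) ^ (1 / 2 : ℝ) := by
  set σδ : Matrix e e ℂ := σ + δ • 1 with hσδ
  have hδ1 : (δ • (1 : Matrix e e ℂ)).PosDef := PosDef.one.smul hδ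
  have hσδp : σδ.PosDef := PosDef.posSemidef_add hσ.1 hδ1
  have htr : σδ.trace.re = 1 + δ * Fintype.card e := by
    rw [hσδ, trace_add, hσ.2, trace_smul, trace_one, Complex.add_re, Complex.one_re,
      Complex.smul_re, Complex.natCast_re, smul_eq_mul]
  have hdiff : ((1 : Matrix (a₁ × a₂) (a₁ × a₂) ℂ) ⊗ₖ σδ -
      (1 : Matrix (a₁ × a₂) (a₁ × a₂) ℂ) ⊗ₖ σ).PosSemidef := by
    rw [hσδ, kronecker_add, add_sub_cancel_left]
    exact PosSemidef.one.kronecker hδ1.posSemidef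
  obtain ⟨X, Z, hX, hXε, hZ, hZX, hQ⟩ := exists_smoothing_le_measuredQ2 hρ
    (PosSemidef.one.kronecker hσ.1) (PosDef.one.kronecker hσδp) hdiff hε
  obtain ⟨hYZ, hle⟩ := trace_mul_sub_maxMixed_le hσδp.posSemidef hZ hZX
  set R := ρ - X with hR
  set Z' := Z - maxMixed (a₁ × a₂) ⊗ₖ marginalE Z with hZ'
  have hZ'H : Z'.IsHermitian := by
    refine hZ.sub ?_
    rw [IsHermitian, conjTranspose_kronecker, (IsHermitian.marginalE hZ).eq,
      posSemidef_maxMixed.isHermitian.eq]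
  have hY0 := trace_mul_lyap_self_nonneg
    ((PosSemidef.one (n := a₁ × a₂) (R := ℂ)).kronecker hσδp.posSemidef) hZ'H
  rw [hYZ, Matrix.trace_mul_comm] at hY0
  refine (hν.lintegral_le_of_le_sqrt hσδp.posSemidef (marginalE_sub_maxMixed R) hZ'H hYZ (κ := ε)
    (fun U => ?_) hε).trans ?_
  · obtain ⟨S, hS, hS2, h⟩ := exists_traceNorm_eq (isHermitian_decouplingDiff hρ.isHermitian U)
    refine ⟨S, hS, hS2, ?_⟩
    -- The part `X` costs at most `½ · 2 Tr X ≤ ε`; this is the constant `κ`.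
    have h1 : decouplingDiff ρ U = decouplingDiff X U + decouplingDiff R U := by
      rw [hR, decouplingDiff_sub]; abel
    have h2 := trace_mul_decouplingDiff_le hX U hS hS2
    rw [h, h1, mul_add, trace_add, Complex.add_re, ← decouplingDiff_eq_traceA2]
    linarith
  set y := ((R - maxMixed (a₁ × a₂) ⊗ₖ marginalE R) * Z').trace.re with hy
  set v := (R * Z).trace.re with hv
  have hv0 : 0 ≤ v := hY0.trans hle
  rw [htr]
  have hw : (Fintype.card a₁ : ℝ) * (1 + δ * Fintype.card e) * (designFactor a₁ a₂ * y) ≤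
      (Fintype.card a₁ : ℝ) / Fintype.card a₂ * ((1 + δ * Fintype.card e) * v) := by
    have h1 : designFactor a₁ a₂ * y ≤ (Fintype.card a₂ : ℝ)⁻¹ * v :=
      (mul_le_mul_of_nonneg_right designFactor_le hY0).trans
        (mul_le_mul_of_nonneg_left hle (by positivity))
    calc _ ≤ (Fintype.card a₁ : ℝ) * (1 + δ * Fintype.card e) * ((Fintype.card a₂ : ℝ)⁻¹ * v) :=
          mul_le_mul_of_nonneg_left h1 (by positivity)
      _ = _ := by ring
  calc _ ≤ ENNReal.ofReal (ε + 1 / 2 * Real.sqrt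
        ((Fintype.card a₁ : ℝ) / Fintype.card a₂ * ((1 + δ * Fintype.card e) * v))) := by
        gcongr
    _ = ENNReal.ofReal ε + 1 / 2 * (ENNReal.ofReal ((Fintype.card a₁ : ℝ) / Fintype.card a₂) *
          (ENNReal.ofReal (1 + δ * Fintype.card e) * ENNReal.ofReal v)) ^ (1 / 2 : ℝ) := by
        have hhalf : ENNReal.ofReal (1 / 2) = 1 / 2 := by
          rw [ENNReal.ofReal_div_of_pos (by norm_num)]
          simp
        rw [ENNReal.ofReal_add hε (by positivity), ENNReal.ofReal_mul (p := 1 / 2) (by norm_num),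
          hhalf, ← ENNReal.ofReal_mul (p := 1 + δ * Fintype.card e) (by positivity),
          ← ENNReal.ofReal_mul (p := (Fintype.card a₁ : ℝ) / Fintype.card a₂) (by positivity),
          ENNReal.ofReal_rpow_of_nonneg (by positivity) (by norm_num), ← Real.sqrt_eq_rpow]
    _ ≤ _ := by gcongr

/-- Only the scalar `1 + δ|E|` depends on `δ`, so the limit `δ → 0` needs no continuity of the
divergence. -/
theorem IsUnitaryTwoDesign.lintegral_traceNorm_le {ν : Measure (unitaryGroup (a₁ × a₂) ℂ)}
    (hν : IsUnitaryTwoDesign ν) {σ : Matrix e e ℂ} (hσ : IsState σ)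
    {ρ : Matrix ((a₁ × a₂) × e) ((a₁ × a₂) × e) ℂ} (hρ : ρ.PosSemidef) {ε : ℝ} (hε : 0 ≤ ε) :
    ∫⁻ U, ENNReal.ofReal (1 / 2 * traceNorm (decouplingDiff ρ U)) ∂ν ≤
      ENNReal.ofReal ε + 1 / 2 *
        (ENNReal.ofReal ((Fintype.card a₁ : ℝ) / (Fintype.card a₂ : ℝ)) *
          measuredQ2 ε ρ ((1 : Matrix (a₁ × a₂) (a₁ × a₂) ℂ) ⊗ₖ σ)) ^ (1 / 2 : ℝ) := by
  set Q := measuredQ2 ε ρ ((1 : Matrix (a₁ × a₂) (a₁ × a₂) ℂ) ⊗ₖ σ) with hQ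
  have hK : (0 : ℝ) < (Fintype.card a₁ : ℝ) / (Fintype.card a₂ : ℝ) := by positivity
  rcases eq_or_ne Q ⊤ with hQt | hQt
  · rw [hQt, ENNReal.mul_top (by simpa using hK), ENNReal.top_rpow_of_pos (by norm_num),
      ENNReal.mul_top (by simp), add_top]
    exact le_top
  have h1 : Filter.Tendsto (fun δ : ℝ => ENNReal.ofReal (1 + δ * Fintype.card e))
      (nhdsWithin 0 (Set.Ioi 0)) (nhds 1) := by
    have : Filter.Tendsto (fun δ : ℝ => ENNReal.ofReal (1 + δ * Fintype.card e)) (nhds 0)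
        (nhds (ENNReal.ofReal (1 + 0 * Fintype.card e))) :=
      (ENNReal.continuous_ofReal.comp (by fun_prop)).tendsto 0
    rw [zero_mul, add_zero, ENNReal.ofReal_one] at this
    exact this.mono_left nhdsWithin_le_nhds
  have h2 := ENNReal.Tendsto.mul_const h1 (b := Q) (Or.inr hQt)
  have h3 := ENNReal.Tendsto.const_mul
    (a := ENNReal.ofReal ((Fintype.card a₁ : ℝ) / (Fintype.card a₂ : ℝ))) h2
    (Or.inr ENNReal.ofReal_ne_top)
  have h4 := ((ENNReal.continuous_rpow_const (y := (1 / 2 : ℝ))).tendsto _).comp h3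
  have h5 := ENNReal.Tendsto.const_mul (a := (1 / 2 : ℝ≥0∞)) h4 (Or.inr (by simp))
  have h6 := h5.const_add (ENNReal.ofReal ε)
  rw [one_mul] at h6
  refine ge_of_tendsto h6 (Filter.eventually_of_mem self_mem_nhdsWithin fun δ hδ => ?_)
  exact hν.lintegral_traceNorm_le_of_pos hσ hρ hε hδ

end MainBounds

end Decoupling

theorem mainTheorem7 {a₁ a₂ e : Type*} [Fintype a₁] [DecidableEq a₁] [Nonempty a₁]
    [Fintype a₂] [DecidableEq a₂] [Nonempty a₂] [Fintype e] [DecidableEq e]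
    (ν : Measure (unitaryGroup (a₁ × a₂) ℂ)) (hν : IsUnitaryTwoDesign ν)
    (σ : Matrix e e ℂ) (hσ : IsState σ) :
    (∀ R : Matrix ((a₁ × a₂) × e) ((a₁ × a₂) × e) ℂ, R.IsHermitian →
      supp R ≤ supp ((1 : Matrix (a₁ × a₂) (a₁ × a₂) ℂ) ⊗ₖ σ) →
      ∫⁻ U, ENNReal.ofReal (plusNorm (decouplingDiff R U)) ∂ν ≤
        ENNReal.ofReal (1 / 2 * Real.sqrt
          ((Fintype.card (a₁ × a₂) : ℝ) * ((Fintype.card a₁ : ℝ) ^ 2 - 1) /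
            ((Fintype.card (a₁ × a₂) : ℝ) ^ 2 - 1))) *
          buresNorm ((1 : Matrix (a₁ × a₂) (a₁ × a₂) ℂ) ⊗ₖ σ)
            (R - maxMixed (a₁ × a₂) ⊗ₖ marginalE R)) ∧
    (∀ ρ : Matrix ((a₁ × a₂) × e) ((a₁ × a₂) × e) ℂ, IsState ρ →
      supp ρ ≤ supp ((1 : Matrix (a₁ × a₂) (a₁ × a₂) ℂ) ⊗ₖ σ) →
      ∀ ε : ℝ, 0 ≤ ε → ε < 1 →
        ∫⁻ U, ENNReal.ofReal (1 / 2 * traceNorm (decouplingDiff ρ U)) ∂ν ≤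
          ENNReal.ofReal ε + 1 / 2 *
            (ENNReal.ofReal ((Fintype.card a₁ : ℝ) / (Fintype.card a₂ : ℝ)) *
              measuredQ2 ε ρ ((1 : Matrix (a₁ × a₂) (a₁ × a₂) ℂ) ⊗ₖ σ)) ^ (1 / 2 : ℝ) ∧
        ENNReal.ofReal ε + 1 / 2 *
            (ENNReal.ofReal ((Fintype.card a₁ : ℝ) / (Fintype.card a₂ : ℝ)) *
              measuredQ2 ε ρ ((1 : Matrix (a₁ × a₂) (a₁ × a₂) ℂ) ⊗ₖ σ)) ^ (1 / 2 : ℝ) ≤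
          ENNReal.ofReal ε + 1 / 2 *
            (ENNReal.ofReal ((Fintype.card a₁ : ℝ) / (Fintype.card a₂ : ℝ)) *
              ENNReal.ofReal (1 - ε) *
              measuredQmax ε ρ ((1 : Matrix (a₁ × a₂) (a₁ × a₂) ℂ) ⊗ₖ σ)) ^ (1 / 2 : ℝ)) := by
  refine ⟨fun R hR _ => ?_, fun ρ hρ _ ε hε0 hε1 => ⟨hν.lintegral_traceNorm_le hσ hρ.1 hε0, ?_⟩⟩
  · rw [← card_mul_designFactor]
    exact hν.lintegral_plusNorm_le hσ hR
  · rw [mul_assoc]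
    gcongr
    exact measuredQ2_le_measuredQmax hε0 hε1 hρ _
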